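/- Let $G=(V,E)$ be a finite undirected graph (parallel edges allowed) with edge weights $w:E\to\mathbb Z_{\ge 0}$, terminals $s,t\in V$ and scenarios $F_1,\dots,F_m\subseteq E$, and let a planar embedding of $G$ be given. For $r\ge 0$, an edge set $S$ is called feasible for level $r$ if for every $j$ and every $F\subseteq F_j$ with $|F|\le r$ the graph $(V,S\setminus F)$ contains an $s$-$t$ path. Let $i\ge 2$ and let $X\subseteq E$ be feasible for level $i-1$. Let $\Omega$ be the family of all sets $F$ such that $F\subseteq F_j$ for some $j$, $|F|\le i$, and $F$ disconnects $s$ from $t$ in $(V,X)$. Assume that every edge of $X$ belongs to at least one $F\in\Omega$. Let $\bar V$ be the set of nodes incident to $X$. For every pair of distinct $u,v\in\bar V$ that is connected in $(V,E\setminus X)$ fix a link $L_{u,v}$, i.e. an arbitrary shortest $u$-$v$ path in $(V,E\setminus X)$ with respect to $w$, and let $\ell_{u,v}=w(L_{u,v})$. The link $L_{u,v}$ covers $F\in\Omega$ if one of $u,v$ is connected to $s$ in $(V,X\setminus F)$ and the other one is connected to $t$. The $i$-th link covering problem asks for a set of links of minimum total cost that is feasible, i.e. that contains for every $F\in\Omega$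 a link covering $F$. Its LP relaxation is $$\min\Big\{\ell(x)=\sum_{\{u,v\}}\ell_{u,v}x_{u,v}\;:\; x_{u,v}\ge 0\ \text{for all links},\quad \sum_{\{u,v\}\,:\,L_{u,v}\text{ covers }F}x_{u,v}\ge 1\ \text{ for all } F\in\Omega\Big\}.$$ A link $L_{u,v}$ is typed if there is a face $\psi$ of the embedding of $(\bar V,X)$ induced by that of $G$ such that $u$ and $v$ lie on $\psi$ and $L_{u,v}$ is contained in $\psi$ (every edge of $L_{u,v}$ lies in $\psi$; its nodes may lie on the boundary). A solution $x$ is clean if $x_{u,v}=0$ for every link $L_{u,v}$ that is not typed. Then: (1) For every clean feasible solution $x$ of the LP there is a feasible set $S$ of links with total cost at most $8i\cdot\ell(x)$. (2) The integrality gap of the LP is at most $8i$: if the LP is feasible, then there is a feasible set $S$ of links whose total cost is at most $8i\cdot\ell(x)$ for every feasible solution $x$ of the LP, clean or not. -/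

import Mathlib

namespace BulkRobust

/-- An undirected graph with vertex type `V` and edge type `E`; parallel edges and loops are allowed.
The edge `e` joins `ends e false` and `ends e true`. -/
structure Multigraph (V E : Type*) where
  ends : E → Bool → V

/-- A dart is an edge together with one of its two directions of traversal. -/
abbrev Dart (E : Type*) := E × Bool

/-- The same edge, traversed in the opposite direction. -/
def flip {E : Type*} (d : Dart E) : Dart E := (d.1, !d.2)

namespace Multigraph

variable {V E : Type*} (G : Multigraph V E)

def tail (d : Dart E) : V := G.ends d.1 d.2

def head (d : Dart E) : V := G.ends d.1 (!d.2)

/-- `G.IsWalk A u p v`: the list of darts `p` is a walk from `u` to `v` in the subgraph `(V, A)`. -/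
def IsWalk (A : Set E) : V → List (Dart E) → V → Prop
  | u, [], v => u = v
  | u, d :: p, v => d.1 ∈ A ∧ G.tail d = u ∧ IsWalk A (G.head d) p v

/-- A path is a walk that visits no vertex twice. -/
def IsPath (A : Set E) (u : V) (p : List (Dart E)) (v : V) : Prop :=
  G.IsWalk A u p v ∧ (u :: p.map G.head).Nodup

/-- `(V, A)` contains a path from `u` to `v`. -/
def Joins (A : Set E) (u v : V) : Prop := ∃ p, G.IsPath A u p v

/-- The nodes incident to an edge of `A`. -/
def nodesOf (A : Set E) : Set V := {u | ∃ d : Dart E, d.1 ∈ A ∧ G.tail d = u}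

/-- `p` is a shortest path from `u` to `v` in `(V, A)` with respect to the edge weights `w`. -/
def IsShortestPath (w : E → ℕ) (A : Set E) (u : V) (p : List (Dart E)) (v : V) : Prop :=
  G.IsPath A u p v ∧
    ∀ q, G.IsPath A u q v → (p.map fun d => w d.1).sum ≤ (q.map fun d => w d.1).sum

end Multigraph

/-- The total weight of a list of darts. -/
def pathWeight {E : Type*} (w : E → ℕ) (p : List (Dart E)) : ℕ := (p.map fun d => w d.1).sum

/-- Faces are traversed by following a dart to its head and then taking the next dart in the rotation
there. -/
def faceNext {E : Type*} (rot : Equiv.Perm (Dart E)) (d : Dart E) : Dart E := rot (flip d)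

/-- A planar (i.e. genus zero) embedding of a finite graph, given combinatorially. `rot` is the
cyclic order in which the darts leaving each vertex are arranged around that vertex. The faces of
the embedding are the orbits of `faceNext rot`, and Euler's formula (vertices) + (faces) =
(edges) + 2 (components) says that every component is drawn on a sphere. Isolated vertices play
no role: only vertices with an incident edge, and components with an edge, are counted. -/
structure PlanarEmbedding {V E : Type*} (G : Multigraph V E) where
  rot : Equiv.Perm (Dart E)
  sameCycle_iff : ∀ d d', rot.SameCycle d d' ↔ G.tail d = G.tail d'
  euler :
    Nat.card (Set.range G.tail) + Nat.card (Quot fun d d' => d' = faceNext rot d) =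
      Nat.card E + 2 * Nat.card (Quot fun d d' => d' = rot d ∨ d' = flip d)

namespace PlanarEmbedding

variable {V E : Type*} {G : Multigraph V E} (Γ : PlanarEmbedding G)

/-- The faces of the embedding of the subgraph with edge set `X` induced by the embedding `Γ` of `G`.
Every face of the subgraph is a union of faces of `G`: two faces of `G` that lie on the two sides
of an edge outside `X` belong to the same face of the subgraph. -/
def Face (X : Set E) : Type _ :=
  Quot fun d d' : Dart E => d' = faceNext Γ.rot d ∨ (d.1 ∉ X ∧ d' = flip d)

/-- The face of the subgraph with edge set `X` on the side of the dart `d`. If the edge of `d` is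
not in `X`, this is the face which contains that edge. -/
def faceOf (X : Set E) (d : Dart E) : Γ.Face X := Quot.mk _ d

/-- The vertex `u` lies on the face `ψ`: one of the corners at `u` belongs to `ψ`. -/
def OnFace (X : Set E) (ψ : Γ.Face X) (u : V) : Prop := ∃ d, G.tail d = u ∧ Γ.faceOf X d = ψ

/-- A path `p` outside `X` with endpoints `u` and `v` is of type `ψ`: it connects two nodes on
`ψ`, and each of its edges is contained in `ψ`. -/
def OfType (X : Set E) (ψ : Γ.Face X) (u : V) (p : List (Dart E)) (v : V) : Prop :=
  Γ.OnFace X ψ u ∧ Γ.OnFace X ψ v ∧ ∀ d ∈ p, d.1 ∉ X ∧ Γ.faceOf X d = ψ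

end PlanarEmbedding

/-- An instance of the bulk-robust `s`-`t` connection problem. -/
structure Problem (V E : Type*) where
  graph : Multigraph V E
  w : E → ℕ
  s : V
  t : V
  m : ℕ
  scenario : Fin m → Finset E

namespace Problem

variable {V E : Type*} (P : Problem V E)

/-- The failure sets of the `i`-th level relaxation. -/
def Omega (i : ℕ) : Set (Finset E) := {F | (∃ j, F ⊆ P.scenario j) ∧ F.card ≤ i}

/-- `S` is a feasible solution of the `i`-th level relaxation. -/
def LevelFeasible (i : ℕ) (S : Set E) : Prop := ∀ F ∈ P.Omega i, P.graph.Joins (S \ ↑F) P.s P.t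

/-- The relevant failure sets of the `i`-th augmentation problem for the current edge set `X`: those
which disconnect `s` from `t` in `(V, X)`. -/
def Relevant (i : ℕ) (X : Set E) : Set (Finset E) :=
  {F ∈ P.Omega i | ¬ P.graph.Joins (X \ ↑F) P.s P.t}

open scoped Classical in
/-- The unordered pairs of distinct nodes incident to `X` which have a link, i.e. which are joined by
a path that uses only edges outside `X`. -/
noncomputable def linkPairs [Fintype V] (X : Set E) : Finset (Sym2 V) :=
  Finset.univ.filter fun e => ∃ u v, e = s(u, v) ∧ u ≠ v ∧
    u ∈ P.graph.nodesOf X ∧ v ∈ P.graph.nodesOf X ∧ P.graph.Joins Xᶜ u v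

/-- `L` assigns to each pair that has a link one such link: a shortest path outside `X`. -/
def IsLinkSystem [Fintype V] (X : Set E) (L : Sym2 V → List (Dart E)) : Prop :=
  ∀ e ∈ P.linkPairs X, ∃ u v, e = s(u, v) ∧ P.graph.IsShortestPath P.w Xᶜ u (L e) v

/-- The link with endpoints `e` covers `F`: its endpoints lie on different sides of the cut formed
by `F` in `(V, X)`. -/
def Covers (X : Set E) (F : Finset E) (e : Sym2 V) : Prop :=
  ∃ u v, e = s(u, v) ∧ P.graph.Joins (X \ ↑F) P.s u ∧ P.graph.Joins (X \ ↑F) P.t v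

/-- `S` is a feasible solution of the `i`-th link covering problem: a set of links (named by their
endpoints) such that each relevant failure set is covered by a link in `S`. -/
def IsLinkCover [Fintype V] (i : ℕ) (X : Set E) (S : Finset (Sym2 V)) : Prop :=
  S ⊆ P.linkPairs X ∧ ∀ F ∈ P.Relevant i X, ∃ e ∈ S, P.Covers X F e

/-- The total cost of a set of links. -/
def linkCost (L : Sym2 V → List (Dart E)) (S : Finset (Sym2 V)) : ℕ :=
  ∑ e ∈ S, pathWeight P.w (L e)

open scoped Classical in
/-- `x` is a feasible solution of the linear programming relaxation of the `i`-th link covering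
problem. Only the values of `x` at pairs that have a link matter. -/
def LPFeasible [Fintype V] (i : ℕ) (X : Set E) (x : Sym2 V → ℝ) : Prop :=
  (∀ e ∈ P.linkPairs X, 0 ≤ x e) ∧
    ∀ F ∈ P.Relevant i X, 1 ≤ ∑ e ∈ (P.linkPairs X).filter (fun e => P.Covers X F e), x e

/-- The objective value `ℓ(x)` of the linear program. -/
noncomputable def lpCost [Fintype V] (X : Set E) (L : Sym2 V → List (Dart E)) (x : Sym2 V → ℝ) : ℝ :=
  ∑ e ∈ P.linkPairs X, (pathWeight P.w (L e) : ℝ) * x e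

/-- The link with endpoints `e` is typed: it is of type `ψ` for a face `ψ` of `(V, X)`. -/
def Typed (Γ : PlanarEmbedding P.graph) (X : Set E) (L : Sym2 V → List (Dart E)) (e : Sym2 V) :
    Prop :=
  ∃ (ψ : Γ.Face X) (u v : V), e = s(u, v) ∧ Γ.OfType X ψ u (L e) v

/-- `x` is clean: it vanishes at each untyped link. -/
def Clean [Fintype V] (Γ : PlanarEmbedding P.graph) (X : Set E) (L : Sym2 V → List (Dart E))
    (x : Sym2 V → ℝ) : Prop :=
  ∀ e ∈ P.linkPairs X, ¬ P.Typed Γ X L e → x e = 0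

end Problem

end BulkRobust

/-!
It suffices to round an arbitrary feasible solution `x` of the linear program, clean or not, to a link
cover of cost at most `8 * i * ℓ(x)`: a cheapest link cover then works for all `x` at once
(`Problem.exists_isLinkCover_le`).

*Topology.* Over the field with two elements, Euler's formula is a dimension count which shows that
each cycle of the plane graph is a sum of face boundaries
(`PlanarEmbedding.orthogonal_coboundaries`). This has two consequences for the connected subgraph `X`:
each of its faces is bounded by a single closed walk (`PlanarEmbedding.sameCycle_boundaryNext`), and
a set of edges that meets each face evenly is a cut (`PlanarEmbedding.exists_nodeFun_of_even`). As
`X` is feasible for the previous level, a relevant failure set `F` is a bond of `X` with at most `i`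
edges. It follows that `F` meets each face in no dart or in exactly two
(`PlanarEmbedding.card_face_darts`).

*Chords.* A link splits into chords, that is, walks through a single face of `X` between two of its
corners, and a link that covers `F` has a chord whose ends lie on different sides of `F`
(`PlanarEmbedding.exists_chords`). Assigning the value of each link to all its chords yields a
fractional chord solution of no larger cost, and a set of chords gives back a set of links of no larger
cost since links are shortest paths. On the boundary walk of a face, cut open to a line, a chord is an
interval, and it joins both sides of `F` if and only if it contains one of the two darts of `F` on
this face but not the other (`PlanarEmbedding.side_ne_iff`).

*Rounding.* `F` has at most `2 * i` darts, so for one of them, `a`, the chords that contain `a` but not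
its mate have total value at least `1 / (2 * i)`. If `a` comes before its mate, and such demands are
processed by increasing position of the mate, then among the chords meeting a demand the two that
reach furthest to the left and to the right meet all later demands that any of them meets. A local
ratio argument therefore loses a factor of two (`exists_cover_le_two_mul`). The demands where `a`
comes after its mate are treated symmetrically, so the total loss is `2 * i * (2 + 2) = 8 * i`.
-/

/-! ### Walks, paths and connectivity -/

namespace BulkRobust

@[simp] lemma flip_flip {E : Type*} (d : Dart E) : flip (flip d) = d := by simp [flip]

@[simp] lemma flip_fst {E : Type*} (d : Dart E) : (flip d).1 = d.1 := rfl

namespace Multigraph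

variable {V E : Type*} {G : Multigraph V E} {A B : Set E} {u v a b : V}

@[simp] lemma tail_flip (G : Multigraph V E) (d : Dart E) : G.tail (flip d) = G.head d := rfl

@[simp] lemma head_flip (G : Multigraph V E) (d : Dart E) : G.head (flip d) = G.tail d := by
  simp [head, tail, flip]

lemma IsWalk.append {p q : List (Dart E)} (hp : G.IsWalk A u p v) (hq : G.IsWalk A v q b) :
    G.IsWalk A u (p ++ q) b := by
  induction p generalizing u with
  | nil => cases hp; exact hq
  | cons d p ih => exact ⟨hp.1, hp.2.1, ih hp.2.2⟩

lemma exists_suffix_isPath {q : List (Dart E)} (hq : G.IsPath A a q v)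
    (hu : u ∈ a :: q.map G.head) : ∃ q', G.IsPath A u q' v ∧ q'.Sublist q := by
  induction q generalizing a with
  | nil =>
    obtain rfl : u = a := by simpa using hu
    exact ⟨[], hq, List.Sublist.refl _⟩
  | cons d q ih =>
    rcases List.mem_cons.1 hu with rfl | hu
    · exact ⟨_, hq, List.Sublist.refl _⟩
    · obtain ⟨q', h, hs⟩ := ih ⟨hq.1.2.2, (List.nodup_cons.1 hq.2).2⟩ hu
      exact ⟨q', h, hs.cons _⟩

/-- Cutting out closed subwalks turns a walk into a path. -/
lemma IsWalk.exists_isPath {p : List (Dart E)} (hp : G.IsWalk A u p v) :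
    ∃ q, G.IsPath A u q v ∧ q.Sublist p := by
  induction p generalizing u with
  | nil => exact ⟨[], ⟨hp, by simp⟩, List.Sublist.refl _⟩
  | cons d p ih =>
    obtain ⟨q, hq, hs⟩ := ih hp.2.2
    by_cases hu : u ∈ G.head d :: q.map G.head
    · obtain ⟨q', hq', hs'⟩ := exists_suffix_isPath hq hu
      exact ⟨q', hq', (hs'.trans hs).cons _⟩
    · exact ⟨d :: q, ⟨⟨hp.1, hp.2.1, hq.1⟩, List.nodup_cons.2 ⟨hu, hq.2⟩⟩, hs.cons_cons _⟩

lemma IsWalk.joins {p : List (Dart E)} (hp : G.IsWalk A u p v) : G.Joins A u v :=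
  let ⟨q, hq, _⟩ := hp.exists_isPath
  ⟨q, hq⟩

lemma joins_iff_reflTransGen : G.Joins A u v ↔
    Relation.ReflTransGen (fun a b => ∃ d : Dart E, d.1 ∈ A ∧ G.tail d = a ∧ G.head d = b) u v := by
  constructor
  · rintro ⟨p, hp, -⟩
    induction p generalizing u with
    | nil => cases hp; exact .refl
    | cons d p ih => exact (ih hp.2.2).head ⟨d, hp.1, hp.2.1, rfl⟩
  · intro h
    suffices ∃ p, G.IsWalk A u p v from let ⟨p, hp⟩ := this; hp.joins
    induction h with
    | refl => exact ⟨[], rfl⟩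
    | tail _ h ih =>
      obtain ⟨p, hp⟩ := ih
      obtain ⟨d, hd, rfl, rfl⟩ := h
      exact ⟨p ++ [d], hp.append ⟨hd, rfl, rfl⟩⟩

lemma Joins.refl (u : V) : G.Joins A u u := joins_iff_reflTransGen.2 .refl

lemma Joins.trans (h : G.Joins A u v) (h' : G.Joins A v b) : G.Joins A u b :=
  joins_iff_reflTransGen.2 ((joins_iff_reflTransGen.1 h).trans (joins_iff_reflTransGen.1 h'))

lemma joins_tail_head {d : Dart E} (hd : d.1 ∈ A) : G.Joins A (G.tail d) (G.head d) :=
  joins_iff_reflTransGen.2 (.single ⟨d, hd, rfl, rfl⟩)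

lemma joins_head_tail {d : Dart E} (hd : d.1 ∈ A) : G.Joins A (G.head d) (G.tail d) := by
  simpa using joins_tail_head (G := G) (A := A) (d := flip d) hd

/-- Induction along a path, starting from its last node. -/
lemma Joins.induction {motive : V → Prop} (h : G.Joins A u v) (hu : motive u)
    (step : ∀ d : Dart E, d.1 ∈ A → motive (G.tail d) → motive (G.head d)) : motive v := by
  induction joins_iff_reflTransGen.1 h with
  | refl => exact hu
  | tail h' hd ih =>
    obtain ⟨d, hd, rfl, rfl⟩ := hd
    exact step d hd (ih (joins_iff_reflTransGen.2 h'))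

lemma Joins.symm (h : G.Joins A u v) : G.Joins A v u :=
  h.induction (motive := fun v => G.Joins A v u) (.refl u)
    fun _ hd ih => (joins_head_tail hd).trans ih

lemma Joins.mono (hAB : A ⊆ B) (h : G.Joins A u v) : G.Joins B u v :=
  h.induction (motive := fun v => G.Joins B u v) (.refl u)
    fun _ hd ih => ih.trans (joins_tail_head (hAB hd))

lemma tail_mem_nodesOf {d : Dart E} (hd : d.1 ∈ A) : G.tail d ∈ G.nodesOf A := ⟨d, hd, rfl⟩

/-- If adding the edge `e` to `A` joins `a` to `b`, then `e` leads from the component of `a` to the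
component of `b`. -/
lemma Joins.exists_dart_of_insert {e : E} (h : G.Joins (insert e A) a b) (hn : ¬ G.Joins A a b) :
    ∃ d : Dart E, d.1 = e ∧ G.Joins A a (G.tail d) ∧ G.Joins A (G.head d) b := by
  by_contra! hc
  -- the component of `a` in `A` is closed under the edges of `insert e A`, or `e` joins it to `v`
  have key : ∀ v, G.Joins (insert e A) a v → G.Joins A a v ∨
      ∃ d : Dart E, d.1 = e ∧ G.Joins A a (G.tail d) ∧ G.Joins A (G.head d) v := by
    intro v hv
    refine hv.induction (motive := fun v => G.Joins A a v ∨
      ∃ d : Dart E, d.1 = e ∧ G.Joins A a (G.tail d) ∧ G.Joins A (G.head d) v)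
      (.inl (.refl _)) fun d hd ih => ?_
    rcases hd with hd | hd
    · rcases ih with ih | ⟨d', rfl, h1, h2⟩
      · exact .inr ⟨d, hd, ih, .refl _⟩
      · obtain ⟨e, x⟩ := d
        obtain ⟨e', y⟩ := d'
        obtain rfl : e = e' := hd
        rcases Bool.eq_or_eq_not x y with rfl | rfl
        · exact .inr ⟨_, rfl, h1, .refl _⟩
        · left
          simpa [head, tail] using h1
    · rcases ih with ih | ⟨d', hd', h1, h2⟩
      · exact .inl (ih.trans (joins_tail_head hd))
      · exact .inr ⟨d', hd', h1, h2.trans (joins_tail_head hd)⟩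
  rcases key b h with h | ⟨d, hd, h1, h2⟩
  · exact hn h
  · exact hc d hd h1 h2

end Multigraph

end BulkRobust

/-! ### The boundary operator of a planar embedding over the field with two elements -/

namespace BulkRobust

/-- The functions on `D` with values in `ZMod 2` that do not distinguish `r`-related elements. -/
def invariants {D : Type*} (r : D → D → Prop) : Submodule (ZMod 2) (D → ZMod 2) where
  carrier := {f | ∀ d d', r d d' → f d = f d'}
  add_mem' hf hg d d' h := by simp [hf d d' h, hg d d' h]
  zero_mem' _ _ _ := rfl
  smul_mem' c f hf d d' h := by simp [hf d d' h]

lemma finrank_invariants {D : Type*} [Finite D] (r : D → D → Prop) :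
    Module.finrank (ZMod 2) (invariants r) = Nat.card (Quot r) := by
  have : Fintype (Quot r) := Fintype.ofFinite _
  let φ : invariants r ≃ₗ[ZMod 2] (Quot r → ZMod 2) :=
    { toFun := fun f => Quot.lift f.1 f.2
      map_add' := fun f g => by ext ⟨d⟩; rfl
      map_smul' := fun c f => by ext ⟨d⟩; rfl
      invFun := fun g => ⟨fun d => g (Quot.mk _ d), fun d d' h => congrArg g (Quot.sound h)⟩
      left_inv := fun f => rfl
      right_inv := fun g => by ext ⟨d⟩; rfl }
  rw [φ.finrank_eq, Module.finrank_fintype_fun_eq_card, Nat.card_eq_fintype_card]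

/-- Adds up the two values of a function on darts at each edge. Applied to a function on the nodes
this is the coboundary (the cut vector); applied to a function on the faces it is the boundary. -/
def edgeSum (E : Type*) : (Dart E → ZMod 2) →ₗ[ZMod 2] (E → ZMod 2) where
  toFun f e := f (e, false) + f (e, true)
  map_add' f g := by ext e; simp; ring
  map_smul' c f := by ext e; simp; ring

lemma edgeSum_apply {E : Type*} (f : Dart E → ZMod 2) (d : Dart E) :
    edgeSum E f d.1 = f d + f (flip d) := by
  obtain ⟨e, _ | _⟩ := d
  · rfl
  · exact add_comm _ _

lemma eq_of_edgeSum_eq_zero {E : Type*} {f : Dart E → ZMod 2} {d : Dart E}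
    (h : edgeSum E f d.1 = 0) : f d = f (flip d) := by
  rw [edgeSum_apply] at h
  exact CharTwo.add_eq_zero.1 h

/-- The dot product of functions on the edges. -/
def edgeForm (E : Type*) [Fintype E] : LinearMap.BilinForm (ZMod 2) (E → ZMod 2) :=
  dotProductBilin (ZMod 2) (ZMod 2)

lemma edgeForm_apply {E : Type*} [Fintype E] (h k : E → ZMod 2) :
    edgeForm E h k = ∑ e, h e * k e := rfl

lemma edgeForm_isRefl (E : Type*) [Fintype E] : (edgeForm E).IsRefl := by
  intro h k
  simp only [edgeForm_apply, mul_comm, imp_self]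

lemma edgeForm_nondegenerate (E : Type*) [Fintype E] : (edgeForm E).Nondegenerate := by
  have h : ∀ h : E → ZMod 2, (∀ k, edgeForm E h k = 0) → h = 0 := fun h hh =>
    (dotProduct_eq_zero_iff (v := h)).1 hh
  exact ⟨h, fun k hk => h k fun h => edgeForm_isRefl E _ _ (hk h)⟩

lemma edgeForm_edgeSum {E : Type*} [Fintype E] (h : E → ZMod 2) (f : Dart E → ZMod 2) :
    edgeForm E h (edgeSum E f) = ∑ d : Dart E, h d.1 * f d := by
  simp only [edgeForm_apply, edgeSum, LinearMap.coe_mk, AddHom.coe_mk, Fintype.sum_prod_type,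
    Fintype.sum_bool]
  exact Finset.sum_congr rfl fun e _ => by ring

lemma flip_bijective (E : Type*) : Function.Bijective (flip : Dart E → Dart E) :=
  Function.Involutive.bijective flip_flip

namespace PlanarEmbedding

variable {V E : Type*} {G : Multigraph V E} (Γ : PlanarEmbedding G)

/-- The functions on the nodes, viewed as functions on darts by evaluating at the tail. -/
abbrev nodeFun : Submodule (ZMod 2) (Dart E → ZMod 2) := invariants fun d d' => d' = Γ.rot d

/-- The functions on the faces, viewed as functions on darts. -/
abbrev faceFun : Submodule (ZMod 2) (Dart E → ZMod 2) :=
  invariants fun d d' => d' = faceNext Γ.rot d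

variable {Γ}

lemma apply_eq_of_mem_nodeFun {f : Dart E → ZMod 2} (hf : f ∈ Γ.nodeFun) {d d' : Dart E}
    (h : G.tail d = G.tail d') : f d = f d' := by
  have hz : ∀ n : ℤ, f ((Γ.rot ^ n) d) = f d := by
    intro n
    induction n using Int.induction_on with
    | zero => rfl
    | succ n ih =>
      rw [add_comm, zpow_add, zpow_one, Equiv.Perm.mul_apply, ← hf _ _ rfl, ih]
    | pred n ih =>
      rw [← ih, hf ((Γ.rot ^ (-(n : ℤ) - 1)) d) _ rfl, ← Equiv.Perm.mul_apply, ← zpow_one_add]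
      congr 3
      ring
  obtain ⟨n, rfl⟩ := (Γ.sameCycle_iff d d').2 h
  exact (hz n).symm

variable (Γ) in
lemma card_range_tail [Finite E] :
    Nat.card (Set.range G.tail) = Module.finrank (ZMod 2) Γ.nodeFun := by
  have h : Γ.nodeFun = invariants fun d d' => (Setoid.ker G.tail) d d' := by
    refine le_antisymm (fun f hf d d' h => apply_eq_of_mem_nodeFun hf h) fun f hf d d' h => ?_
    subst h
    exact hf _ _ ((Γ.sameCycle_iff _ _).1 (Equiv.Perm.sameCycle_apply_right.2 (.refl _ _)))
  rw [h, finrank_invariants]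
  exact Nat.card_congr (Setoid.quotientKerEquivRange G.tail).symm

lemma finrank_map_edgeSum [Finite E] (W : Submodule (ZMod 2) (Dart E → ZMod 2)) :
    Module.finrank (ZMod 2) (W.map (edgeSum E)) +
      Module.finrank (ZMod 2) (W ⊓ LinearMap.ker (edgeSum E) : Submodule _ _) =
      Module.finrank (ZMod 2) W := by
  have h := LinearMap.finrank_range_add_finrank_ker ((edgeSum E).comp W.subtype)
  rw [LinearMap.range_comp, Submodule.range_subtype, LinearMap.ker_comp] at h
  rw [← h, ← Submodule.map_comap_subtype,
    (Submodule.equivMapOfInjective W.subtype W.injective_subtype _).finrank_eq]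

lemma mem_ker_edgeSum {f : Dart E → ZMod 2} :
    f ∈ LinearMap.ker (edgeSum E) ↔ ∀ d, f d = f (flip d) := by
  refine ⟨fun h d => eq_of_edgeSum_eq_zero (by rw [LinearMap.mem_ker.1 h]; rfl), fun h => ?_⟩
  ext e
  have := edgeSum_apply f (e, false)
  rwa [← h, CharTwo.add_self_eq_zero] at this

variable (Γ) in
lemma nodeFun_inf_ker : Γ.nodeFun ⊓ LinearMap.ker (edgeSum E) =
    invariants fun d d' => d' = Γ.rot d ∨ d' = flip d := by
  ext f
  simp only [Submodule.mem_inf, mem_ker_edgeSum]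
  constructor
  · rintro ⟨h, h'⟩ d _ (rfl | rfl)
    exacts [h _ _ rfl, h' d]
  · exact fun h => ⟨fun d d' hd => h _ _ (.inl hd), fun d => h _ _ (.inr rfl)⟩

variable (Γ) in
lemma faceFun_inf_ker : Γ.faceFun ⊓ LinearMap.ker (edgeSum E) =
    invariants fun d d' => d' = Γ.rot d ∨ d' = flip d := by
  ext f
  simp only [Submodule.mem_inf, mem_ker_edgeSum]
  constructor
  · rintro ⟨h, h'⟩ d _ (rfl | rfl)
    · rw [h' d, h (flip d) _ rfl, faceNext, flip_flip]
    · exact h' d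
  · rintro h
    have h' : ∀ d, f d = f (flip d) := fun d => h _ _ (.inr rfl)
    refine ⟨?_, h'⟩
    rintro d _ rfl
    rw [h' d]
    exact h _ _ (.inl rfl)

/-- Coboundaries of node functions are orthogonal to boundaries of face functions. -/
lemma edgeForm_edgeSum_edgeSum [Fintype E] {f g : Dart E → ZMod 2} (hf : f ∈ Γ.nodeFun)
    (hg : g ∈ Γ.faceFun) : edgeForm E (edgeSum E f) (edgeSum E g) = 0 := by
  have h : ∑ d : Dart E, f (flip d) * g d = ∑ d : Dart E, f d * g d :=
    Fintype.sum_bijective (faceNext Γ.rot) (Γ.rot.bijective.comp (flip_bijective E)) _ _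
      fun d => by rw [hf (flip d) _ rfl, hg d _ rfl]; rfl
  simp only [edgeForm_edgeSum, edgeSum_apply, add_mul, Finset.sum_add_distrib, h,
    CharTwo.add_self_eq_zero]

/-- In genus zero each cycle is a sum of face boundaries. -/
theorem orthogonal_coboundaries [Fintype E] :
    (edgeForm E).orthogonal (Γ.nodeFun.map (edgeSum E)) = Γ.faceFun.map (edgeSum E) := by
  symm
  refine Submodule.eq_of_le_of_finrank_eq ?_ ?_
  · rintro _ ⟨g, hg, rfl⟩ _ ⟨f, hf, rfl⟩
    exact edgeForm_edgeSum_edgeSum hf hg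
  · have h1 := finrank_map_edgeSum Γ.nodeFun
    have h2 := finrank_map_edgeSum Γ.faceFun
    rw [nodeFun_inf_ker] at h1
    rw [faceFun_inf_ker] at h2
    have h3 := Γ.euler
    rw [Γ.card_range_tail, ← finrank_invariants, ← finrank_invariants] at h3
    have h4 : Module.finrank (ZMod 2) (E → ZMod 2) = Nat.card E := by
      rw [Module.finrank_fintype_fun_eq_card, Nat.card_eq_fintype_card]
    have h5 := Submodule.finrank_le (Γ.nodeFun.map (edgeSum E))
    rw [LinearMap.BilinForm.finrank_orthogonal (edgeForm_nondegenerate E), h4]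
    unfold nodeFun faceFun at *
    omega

variable (Γ) in
/-- The functions on the faces of the subgraph with edge set `X`, viewed as functions on darts. -/
abbrev subFaceFun (X : Set E) : Submodule (ZMod 2) (Dart E → ZMod 2) :=
  invariants fun d d' => d' = faceNext Γ.rot d ∨ (d.1 ∉ X ∧ d' = flip d)

/-- A cycle of the subgraph `X` bounds a union of faces of the subgraph. -/
lemma exists_subFaceFun_of_cycle [Fintype E] {X : Set E} {h : E → ZMod 2}
    (hX : ∀ e ∉ X, h e = 0)
    (hh : ∀ f ∈ Γ.nodeFun, edgeForm E h (edgeSum E f) = 0) :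
    ∃ g ∈ Γ.subFaceFun X, edgeSum E g = h := by
  have : h ∈ Γ.faceFun.map (edgeSum E) := by
    rw [← orthogonal_coboundaries]
    rintro _ ⟨f, hf, rfl⟩
    exact edgeForm_isRefl E _ _ (hh f hf)
  obtain ⟨g, hg, rfl⟩ := this
  refine ⟨g, ?_, rfl⟩
  rintro d d' (h | ⟨hd, rfl⟩)
  · exact hg _ _ h
  · exact eq_of_edgeSum_eq_zero (hX _ hd)

/-- A set of edges of the subgraph `X` that meets each face of the subgraph in an even number of
darts is a cut of the subgraph: duality between cycles and cuts. -/
theorem exists_nodeFun_of_even [Fintype E] {X : Set E} {f : E → ZMod 2}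
    (hf : ∀ g ∈ Γ.subFaceFun X, ∑ d : Dart E, f d.1 * g d = 0) :
    ∃ c ∈ Γ.nodeFun, ∀ e ∈ X, edgeSum E c e = f e := by
  let K : Submodule (ZMod 2) (E → ZMod 2) :=
    { carrier := {k | ∀ e ∈ X, k e = 0}
      add_mem' := fun ha hb e he => by simp [ha e he, hb e he]
      zero_mem' := fun _ _ => rfl
      smul_mem' := fun c a ha e he => by simp [ha e he] }
  have hmem : f ∈ Γ.nodeFun.map (edgeSum E) ⊔ K := by
    rw [← LinearMap.BilinForm.orthogonal_orthogonal (edgeForm_nondegenerate E)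
      (edgeForm_isRefl E) (_ ⊔ K)]
    intro h hh
    classical
    have hX : ∀ e ∉ X, h e = 0 := by
      intro e he
      have := hh (Pi.single e 1) (Submodule.mem_sup_right fun e' he' =>
        Pi.single_eq_of_ne (fun h => he (h ▸ he') : e' ≠ e) _)
      simpa [edgeForm_apply, Pi.single_apply] using this
    obtain ⟨g, hg, rfl⟩ := exists_subFaceFun_of_cycle (Γ := Γ) hX fun k hk =>
      edgeForm_isRefl E _ _ (hh _ (Submodule.mem_sup_left ⟨k, hk, rfl⟩))
    have := hf g hg
    rw [← edgeForm_edgeSum] at this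
    exact edgeForm_isRefl E _ _ this
  obtain ⟨_, ⟨c, hc, rfl⟩, k, hk, rfl⟩ := Submodule.mem_sup.1 hmem
  exact ⟨c, hc, fun e he => by simp [hk e he]⟩

end PlanarEmbedding

end BulkRobust

/-! ### The boundary walks of the faces of a subgraph -/

namespace BulkRobust

namespace PlanarEmbedding

variable {V E : Type*} {G : Multigraph V E} (Γ : PlanarEmbedding G) (X : Set E)

open scoped Classical in
/-- The first dart of `X` met when rotating around the tail of `d`, starting with `d` itself. If `X`
has no dart at this node, the value is `d`. -/
noncomputable def corner (d : Dart E) : Dart E :=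
  if h : ∃ k, (Γ.rot^[k] d).1 ∈ X then Γ.rot^[Nat.find h] d else d

variable {Γ X}

lemma tail_rot (d : Dart E) : G.tail (Γ.rot d) = G.tail d :=
  ((Γ.sameCycle_iff _ _).1 (Equiv.Perm.sameCycle_apply_right.2 (.refl _ _))).symm

lemma corner_of_mem {d : Dart E} (hd : d.1 ∈ X) : Γ.corner X d = d := by
  classical
  have h : ∃ k, (Γ.rot^[k] d).1 ∈ X := ⟨0, hd⟩
  rw [corner, dif_pos h, (Nat.find_eq_zero h).2 hd, Function.iterate_zero_apply]

lemma corner_rot_of_notMem {d : Dart E} (hd : d.1 ∉ X) (h : ∃ k, (Γ.rot^[k] d).1 ∈ X) :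
    Γ.corner X (Γ.rot d) = Γ.corner X d := by
  classical
  have h' : ∃ k, (Γ.rot^[k] (Γ.rot d)).1 ∈ X := by
    obtain ⟨_ | k, hk⟩ := h
    exacts [absurd hk hd, ⟨k, hk⟩]
  have hs := Nat.find_comp_succ h h' hd
  rw [corner, dif_pos h', corner, dif_pos h, hs, Function.iterate_succ_apply]
  rfl

lemma exists_iterate_rot_eq [Finite E] {d d' : Dart E} (h : G.tail d = G.tail d') :
    ∃ k, Γ.rot^[k] d = d' := by
  obtain ⟨k, -, -, hk⟩ := ((Γ.sameCycle_iff _ _).2 h).exists_pow_eq''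
  exact ⟨k, by rw [Equiv.Perm.iterate_eq_pow, hk]⟩

lemma exists_iterate_rot_mem [Finite E] {d : Dart E} (h : G.tail d ∈ G.nodesOf X) :
    ∃ k, (Γ.rot^[k] d).1 ∈ X := by
  obtain ⟨d', hd', h'⟩ := h
  obtain ⟨k, hk⟩ := exists_iterate_rot_eq (Γ := Γ) h'.symm
  exact ⟨k, hk ▸ hd'⟩

lemma corner_mem [Finite E] {d : Dart E} (h : G.tail d ∈ G.nodesOf X) : (Γ.corner X d).1 ∈ X := by
  classical
  have h' := exists_iterate_rot_mem (Γ := Γ) h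
  rw [corner, dif_pos h']
  exact Nat.find_spec h'

lemma faceOf_faceNext (d : Dart E) : Γ.faceOf X (faceNext Γ.rot d) = Γ.faceOf X d :=
  (Quot.sound (.inl rfl)).symm

lemma faceOf_flip {d : Dart E} (hd : d.1 ∉ X) : Γ.faceOf X (flip d) = Γ.faceOf X d :=
  (Quot.sound (.inr ⟨hd, rfl⟩)).symm

/-- Rotating across an edge outside `X` does not leave the face. -/
lemma faceOf_rot {d : Dart E} (hd : d.1 ∉ X) : Γ.faceOf X (Γ.rot d) = Γ.faceOf X d := by
  rw [← faceOf_flip hd, ← faceOf_faceNext (flip d), faceNext, flip_flip]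

lemma corner_induction {motive : Dart E → Prop} {d : Dart E} (h0 : motive d)
    (h : ∀ d : Dart E, d.1 ∉ X → motive d → motive (Γ.rot d)) : motive (Γ.corner X d) := by
  classical
  rw [corner]
  split_ifs with hk
  · have : ∀ k ≤ Nat.find hk, motive (Γ.rot^[k] d) := by
      intro k hle
      induction k with
      | zero => exact h0
      | succ k ih =>
        rw [Function.iterate_succ_apply']
        exact h _ (Nat.find_min hk hle) (ih (Nat.le_of_succ_le hle))
    exact this _ le_rfl
  · exact h0

lemma tail_corner (d : Dart E) : G.tail (Γ.corner X d) = G.tail d :=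
  corner_induction (motive := fun d' => G.tail d' = G.tail d) rfl
    fun d' _ h => (tail_rot d').trans h

lemma faceOf_corner (d : Dart E) : Γ.faceOf X (Γ.corner X d) = Γ.faceOf X d :=
  corner_induction (motive := fun d' => Γ.faceOf X d' = Γ.faceOf X d) rfl
    fun _ hd h => (faceOf_rot hd).trans h

lemma corner_rot_injOn [Finite E] {a b : Dart E} (ha : a.1 ∈ X) (hb : b.1 ∈ X)
    (h : Γ.corner X (Γ.rot a) = Γ.corner X (Γ.rot b)) : a = b := by
  classical
  have ha' : ∃ k, (Γ.rot^[k] (Γ.rot a)).1 ∈ X :=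
    exists_iterate_rot_mem (tail_rot (Γ := Γ) a ▸ Multigraph.tail_mem_nodesOf ha)
  have hb' : ∃ k, (Γ.rot^[k] (Γ.rot b)).1 ∈ X :=
    exists_iterate_rot_mem (tail_rot (Γ := Γ) b ▸ Multigraph.tail_mem_nodesOf hb)
  wlog hle : Nat.find ha' ≤ Nat.find hb' generalizing a b
  · exact (this hb ha h.symm hb' ha' (le_of_not_ge hle)).symm
  rw [corner, dif_pos ha', corner, dif_pos hb', ← Function.iterate_succ_apply,
    ← Function.iterate_succ_apply] at h
  obtain ⟨m, hm⟩ := Nat.exists_eq_add_of_le hle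
  rw [hm, ← Nat.succ_add, Function.iterate_add_apply] at h
  obtain rfl := (Γ.rot.injective.iterate _) h
  -- a later return of `b` to `X` would not be the first one
  rcases m with _ | m
  · rfl
  · rw [Function.iterate_succ_apply] at ha
    exact absurd ha (Nat.find_min hb' (by omega))

variable (Γ X) in
/-- The boundary walk of the faces of the subgraph with edge set `X`: a dart of `X` is followed by
the next dart of `X` in the rotation at its head. -/
noncomputable def boundaryNext [Finite E] : Equiv.Perm {d : Dart E // d.1 ∈ X} :=
  Equiv.ofBijective
    (fun d => ⟨Γ.corner X (Γ.rot (flip d.1)),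
      corner_mem (by rw [tail_rot]; exact Multigraph.tail_mem_nodesOf (d := flip d.1) d.2)⟩)
    (Finite.injective_iff_bijective.1 fun a b h => Subtype.ext <| (flip_bijective E).injective <|
      corner_rot_injOn (a := flip a.1) (b := flip b.1) a.2 b.2 (Subtype.ext_iff.1 h))

lemma boundaryNext_apply [Finite E] (d : {d : Dart E // d.1 ∈ X}) :
    (Γ.boundaryNext X d : Dart E) = Γ.corner X (Γ.rot (flip d.1)) := rfl

lemma tail_boundaryNext [Finite E] (d : {d : Dart E // d.1 ∈ X}) :
    G.tail (Γ.boundaryNext X d : Dart E) = G.head d.1 := by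
  rw [boundaryNext_apply, tail_corner, tail_rot, Multigraph.tail_flip]

lemma faceOf_boundaryNext [Finite E] (d : {d : Dart E // d.1 ∈ X}) :
    Γ.faceOf X (Γ.boundaryNext X d : Dart E) = Γ.faceOf X d.1 := by
  rw [boundaryNext_apply, faceOf_corner]
  exact faceOf_faceNext d.1

lemma apply_eq_of_mem_subFaceFun {g : Dart E → ZMod 2} (hg : g ∈ Γ.subFaceFun X) {d d' : Dart E}
    (h : Γ.faceOf X d = Γ.faceOf X d') : g d = g d' :=
  congrArg (Quot.lift g hg) h

lemma sum_dart_eq_sum_subtype {M : Type*} [AddCommMonoid M] [Fintype E]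
    [Fintype {d : Dart E // d.1 ∈ X}] {f : Dart E → M}
    (hf : ∀ d : Dart E, d.1 ∉ X → f d = 0) : ∑ d, f d = ∑ d : {d : Dart E // d.1 ∈ X}, f d.1 := by
  classical
  rw [← Finset.sum_filter_of_ne (p := fun d : Dart E => d.1 ∈ X)
    fun d _ hd => by_contra fun h => hd (hf d h)]
  exact Finset.sum_subtype _ (by simp) f

/-- A function on the darts of a connected subgraph which is invariant under reversal and under
walking along face boundaries is constant. -/
lemma eq_of_invariant [Finite E]
    (hconn : ∀ d d' : Dart E, d.1 ∈ X → d'.1 ∈ X → G.Joins X (G.tail d) (G.tail d'))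
    {k : Dart E → ZMod 2} (hflip : ∀ d : Dart E, d.1 ∈ X → k (flip d) = k d)
    (hnext : ∀ d : {d : Dart E // d.1 ∈ X}, k (Γ.boundaryNext X d) = k d)
    {d d' : Dart E} (hd : d.1 ∈ X) (hd' : d'.1 ∈ X) : k d = k d' := by
  classical
  -- the value at the corner of a dart depends only on the tail of the dart
  let K : Dart E → ZMod 2 := fun d => if (Γ.corner X d).1 ∈ X then k (Γ.corner X d) else 0
  have hK : K ∈ Γ.nodeFun := by
    rintro a _ rfl
    by_cases ha : a.1 ∈ X
    · have h := hnext ⟨flip a, ha⟩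
      have h' := (Γ.boundaryNext X ⟨flip a, ha⟩).2
      rw [boundaryNext_apply, flip_flip] at h h'
      simp only [K]
      rw [if_pos h', h, corner_of_mem ha, if_pos ha, hflip a ha]
    · by_cases h : ∃ k, (Γ.rot^[k] a).1 ∈ X
      · simp only [K, corner_rot_of_notMem ha h]
      · have h1 : (Γ.corner X a).1 ∉ X := by
          rw [corner, dif_neg h]
          exact ha
        have h2 : (Γ.corner X (Γ.rot a)).1 ∉ X := by
          have h' : ¬ ∃ k, (Γ.rot^[k] (Γ.rot a)).1 ∈ X := fun ⟨k, hk⟩ => h ⟨k + 1, hk⟩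
          rw [corner, dif_neg h']
          exact fun hr => h ⟨1, hr⟩
        simp only [K, if_neg h1, if_neg h2]
  have hKk : ∀ a : Dart E, a.1 ∈ X → K a = k a := fun a ha => by
    simp only [K, corner_of_mem ha, if_pos ha]
  have htail : ∀ a b : Dart E, a.1 ∈ X → b.1 ∈ X → G.tail a = G.tail b → k a = k b :=
    fun a b ha hb h => by rw [← hKk a ha, ← hKk b hb, apply_eq_of_mem_nodeFun hK h]
  refine (hconn d d' hd hd').induction
    (motive := fun v => ∀ a : Dart E, a.1 ∈ X → G.tail a = v → k d = k a)
    (fun a ha h => htail d a hd ha h.symm) (fun b hb ih a ha h => ?_) d' hd' rfl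
  rw [ih b hb rfl, ← hflip b hb]
  exact htail _ _ hb ha h.symm

/-- The faces of a connected subgraph of a plane graph are discs: each is bounded by a single closed
walk. Otherwise one of the closed walks around the face would be a cycle that does not bound. -/
theorem sameCycle_boundaryNext [Finite E]
    (hconn : ∀ d d' : Dart E, d.1 ∈ X → d'.1 ∈ X → G.Joins X (G.tail d) (G.tail d'))
    {d d' : {d : Dart E // d.1 ∈ X}} (h : Γ.faceOf X d.1 = Γ.faceOf X d'.1) :
    (Γ.boundaryNext X).SameCycle d d' := by
  classical
  have := Fintype.ofFinite E
  let o' : {d : Dart E // d.1 ∈ X} → ZMod 2 :=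
    fun a => if (Γ.boundaryNext X).SameCycle d a then 1 else 0
  have ho' : ∀ a, o' (Γ.boundaryNext X a) = o' a := fun a => by
    simp only [o', Equiv.Perm.sameCycle_apply_right]
  let o : Dart E → ZMod 2 := fun a => if ha : a.1 ∈ X then o' ⟨a, ha⟩ else 0
  have ho : ∀ a : {d : Dart E // d.1 ∈ X}, o a = o' a := fun a => dif_pos a.2
  have hoX : ∀ a : Dart E, a.1 ∉ X → o a = 0 := fun a ha => dif_neg ha
  -- the edges traversed by the closed walk through `d` form a cycle
  obtain ⟨g, hg, hgo⟩ := exists_subFaceFun_of_cycle (Γ := Γ) (X := X) (h := edgeSum E o)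
    (fun e he => by
      rw [show edgeSum E o e = o (e, false) + o (e, true) from rfl, hoX _ he, hoX _ he, add_zero])
    (fun f hf => by
      have h1 : ∑ a : Dart E, o (flip a) * f a = ∑ a : Dart E, o a * f (flip a) :=
        Fintype.sum_bijective flip (flip_bijective E) _ _ fun a => by rw [flip_flip]
      simp only [edgeForm_edgeSum, edgeSum_apply, add_mul, Finset.sum_add_distrib, h1]
      rw [sum_dart_eq_sum_subtype (X := X) fun a ha => by rw [hoX a ha, zero_mul],
        sum_dart_eq_sum_subtype (X := X) fun a ha => by rw [hoX a ha, zero_mul],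
        ← Equiv.sum_comp (Γ.boundaryNext X)]
      have h2 : ∀ a : {d : Dart E // d.1 ∈ X}, o (Γ.boundaryNext X a) * f (Γ.boundaryNext X a) =
          o a * f (flip a) := fun a => by
        rw [ho, ho' a, ho, apply_eq_of_mem_nodeFun hf (d' := flip a.1) (tail_boundaryNext a)]
      simp only [h2, CharTwo.add_self_eq_zero])
  -- the difference of the closed walk and the faces it bounds is invariant, hence constant
  have hk := eq_of_invariant (Γ := Γ) hconn (k := o + g)
    (fun a _ => (eq_of_edgeSum_eq_zero (by
      rw [map_add, hgo, Pi.add_apply, CharTwo.add_self_eq_zero])).symm)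
    (fun a => by
      rw [Pi.add_apply, Pi.add_apply, ho, ho' a, ho,
        apply_eq_of_mem_subFaceFun hg (faceOf_boundaryNext a)]) d.2 d'.2
  rw [Pi.add_apply, Pi.add_apply, apply_eq_of_mem_subFaceFun hg h, add_left_inj, ho, ho] at hk
  by_contra hn
  simp [o', hn, Equiv.Perm.SameCycle.refl] at hk

end PlanarEmbedding

end BulkRobust

/-! ### Bonds are simple cycles of the dual graph -/

namespace BulkRobust

/-- Positions along the cycles of a permutation: going from `d` to a later element `d'` of the same
cycle, the position increases by one in each step. -/
lemma exists_position {D Ψ : Type*} [Finite D] (σ : Equiv.Perm D) (face : D → Ψ)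
    (hface : ∀ d, face (σ d) = face d) (hσ : ∀ d d', face d = face d' → σ.SameCycle d d') :
    ∃ pos : D → ℕ, ∀ d d', face d = face d' → pos d ≤ pos d' →
      σ^[pos d' - pos d] d = d' ∧ ∀ l ≤ pos d' - pos d, pos (σ^[l] d) = pos d + l := by
  classical
  rcases isEmpty_or_nonempty D with _ | _
  · exact ⟨fun _ => 0, fun d => isEmptyElim d⟩
  let base : Ψ → D := Function.invFun face
  have hbase : ∀ d, face (base (face d)) = face d := fun d => Function.invFun_eq ⟨d, rfl⟩
  have hex : ∀ d, ∃ n, σ^[n] (base (face d)) = d := fun d => by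
    obtain ⟨n, -, -, hn⟩ := (hσ _ _ (hbase d)).exists_pow_eq''
    exact ⟨n, by rw [Equiv.Perm.iterate_eq_pow, hn]⟩
  have hit : ∀ l d, face (σ^[l] d) = face d := fun l d => by
    induction l with
    | zero => rfl
    | succ l ih => rw [Function.iterate_succ_apply', hface, ih]
  refine ⟨fun d => Nat.find (hex d), fun d d' h hle => ?_⟩
  dsimp only at hle ⊢
  have hd := Nat.find_spec (hex d)
  have hd' := Nat.find_spec (hex d')
  set m := Nat.find (hex d) with hm
  set n := Nat.find (hex d') with hn
  refine ⟨?_, fun l hl => ?_⟩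
  · conv_lhs => rw [← hd]
    rw [← Function.iterate_add_apply, Nat.sub_add_cancel hle, h, hd']
  · have hl' : σ^[m + l] (base (face d)) = σ^[l] d := by
      rw [add_comm, Function.iterate_add_apply, hd]
    rw [Nat.find_eq_iff]
    refine ⟨by rw [hit, hl'], fun j hj hjl => ?_⟩
    rw [hit, ← hl'] at hjl
    -- otherwise `d'` would be reached from the base point in fewer steps
    have : σ^[n - m - l + j] (base (face d')) = d' := by
      rw [← h, Function.iterate_add_apply, hjl, ← Function.iterate_add_apply, ← hd', h]
      congr 1
      omega
    exact Nat.find_min (hex d') (m := n - m - l + j) (by omega) this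

namespace PlanarEmbedding

variable {V E : Type*} {G : Multigraph V E} {Γ : PlanarEmbedding G} {X : Set E}

open scoped Classical in
/-- A bond `F` of the subgraph `X` is a simple cycle of its dual: it meets each face in no dart or
in exactly two. The number of darts at a face is even. A bond contains no smaller cut, so the cycle
space of the dual graph formed by `F` has dimension at most one, hence `F` meets at least `|F|`
faces. -/
theorem card_face_darts [Fintype E] {F : Finset E} (hFX : ∀ e ∈ F, e ∈ X) {c : V → ZMod 2}
    (hc : ∀ d : Dart E, d.1 ∈ X → c (G.tail d) + c (G.head d) = if d.1 ∈ F then 1 else 0)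
    (hbond : ∀ k ∈ Γ.nodeFun, (∀ e ∈ X, e ∉ F → edgeSum E k e = 0) →
      ∀ e ∈ F, ∀ e' ∈ F, edgeSum E k e = edgeSum E k e') (a : Dart E) (ha : a.1 ∈ F) :
    (Finset.univ.filter fun d : Dart E => d.1 ∈ F ∧ Γ.faceOf X d = Γ.faceOf X a).card = 2 := by
  have : Fintype (Γ.Face X) := Fintype.ofFinite (Quot _)
  let D : Finset (Dart E) := Finset.univ.filter fun d => d.1 ∈ F
  let M : Finset (Γ.Face X) := D.image (Γ.faceOf X)
  let deg : Γ.Face X → ℕ := fun ψ =>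
    (Finset.univ.filter fun d : Dart E => d.1 ∈ F ∧ Γ.faceOf X d = ψ).card
  have hdeg : ∀ ψ, deg ψ = (D.filter fun d => Γ.faceOf X d = ψ).card := fun ψ => by
    simp only [deg, D, Finset.filter_filter]
  have haM : Γ.faceOf X a ∈ M := Finset.mem_image_of_mem _ (by simp [D, ha])
  have hD : D.card = 2 * F.card := by
    have : D = F ×ˢ (Finset.univ : Finset Bool) := by ext ⟨e, b⟩; simp [D]
    rw [this, Finset.card_product, Finset.card_univ, Fintype.card_bool, mul_comm]
  have hsum : ∑ ψ ∈ M, deg ψ = 2 * F.card := by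
    rw [← hD, Finset.card_eq_sum_card_image (Γ.faceOf X) D]
    exact Finset.sum_congr rfl fun ψ _ => hdeg ψ
  -- walking around the face, the side of the bond changes an even number of times
  have heven : ∀ ψ, Even (deg ψ) := fun ψ => by
    rw [← ZMod.natCast_eq_zero_iff_even]
    have h1 : (deg ψ : ZMod 2) = ∑ d : {d : Dart E // d.1 ∈ X},
        if Γ.faceOf X d.1 = ψ then c (G.tail d.1) + c (G.head d.1) else 0 := by
      rw [Finset.natCast_card_filter, sum_dart_eq_sum_subtype (X := X) fun d hd =>
        if_neg fun h => hd (hFX _ h.1)]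
      refine Finset.sum_congr rfl fun d _ => ?_
      rw [hc d.1 d.2]
      by_cases h1 : d.1.1 ∈ F <;> by_cases h2 : Γ.faceOf X d.1 = ψ <;> simp [h1, h2]
    have h2 : ∀ d : {d : Dart E // d.1 ∈ X},
        (if Γ.faceOf X d.1 = ψ then c (G.tail d.1) + c (G.head d.1) else 0) =
        (if Γ.faceOf X d.1 = ψ then c (G.tail d.1) else 0) +
        (if Γ.faceOf X (Γ.boundaryNext X d).1 = ψ then c (G.tail (Γ.boundaryNext X d).1) else 0) :=
      fun d => by
        rw [faceOf_boundaryNext, tail_boundaryNext]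
        split_ifs <;> simp
    rw [h1, Finset.sum_congr rfl fun d _ => h2 d, Finset.sum_add_distrib,
      Equiv.sum_comp (Γ.boundaryNext X) fun d => if Γ.faceOf X d.1 = ψ then c (G.tail d.1) else 0,
      CharTwo.add_self_eq_zero]
  have htwo : ∀ ψ ∈ M, 2 ≤ deg ψ := fun ψ hψ => by
    obtain ⟨d, hd, rfl⟩ := Finset.mem_image.1 hψ
    have : 0 < deg (Γ.faceOf X d) := Finset.card_pos.2 ⟨d, by simpa [D] using hd⟩
    obtain ⟨r, hr⟩ := heven (Γ.faceOf X d)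
    omega
  have hcard : F.card ≤ M.card := by
    -- the incidence map from the edges of `F` to all but one of the faces met by `F`
    let ext : (F → ZMod 2) →ₗ[ZMod 2] (E → ZMod 2) :=
      { toFun := fun y e => if h : e ∈ F then y ⟨e, h⟩ else 0
        map_add' := fun y z => by ext e; by_cases h : e ∈ F <;> simp [h]
        map_smul' := fun r y => by ext e; by_cases h : e ∈ F <;> simp [h] }
    have hext : ∀ y e, e ∉ F → ext y e = 0 := fun y e he => dif_neg he
    let T : (F → ZMod 2) →ₗ[ZMod 2] (M.erase (Γ.faceOf X a) → ZMod 2) :=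
      { toFun := fun y ψ => ∑ d : Dart E, if Γ.faceOf X d = ψ.1 then ext y d.1 else 0
        map_add' := fun y z => by
          ext ψ
          simp only [map_add, Pi.add_apply, ← Finset.sum_add_distrib]
          exact Finset.sum_congr rfl fun d _ => by split_ifs <;> simp
        map_smul' := fun r y => by
          ext ψ
          simp only [map_smul, Pi.smul_apply, smul_eq_mul, RingHom.id_apply, Finset.mul_sum]
          exact Finset.sum_congr rfl fun d _ => by split_ifs <;> simp }
    have hker : LinearMap.ker T ≤ Submodule.span (ZMod 2) {fun _ => 1} := by
      intro y hy
      let S : Γ.Face X → ZMod 2 := fun ψ => ∑ d : Dart E, if Γ.faceOf X d = ψ then ext y d.1 else 0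
      have hS1 : ∀ ψ, ψ ≠ Γ.faceOf X a → S ψ = 0 := fun ψ hψ => by
        by_cases hM : ψ ∈ M
        · exact congrFun (LinearMap.mem_ker.1 hy) ⟨ψ, Finset.mem_erase.2 ⟨hψ, hM⟩⟩
        · refine Finset.sum_eq_zero fun d _ => ?_
          split_ifs with h
          · exact hext _ _ fun hd => hM (Finset.mem_image.2 ⟨d, by simp [D, hd], h⟩)
          · rfl
      have hS2 : ∑ ψ, S ψ = 0 := by
        simp only [S]
        rw [Finset.sum_comm]
        simp only [Finset.sum_ite_eq, Finset.mem_univ, if_true, Fintype.sum_prod_type,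
          Fintype.sum_bool, CharTwo.add_self_eq_zero, Finset.sum_const_zero]
      have hS : ∀ ψ, S ψ = 0 := fun ψ => by
        by_cases hψ : ψ = Γ.faceOf X a
        · rwa [hψ, ← Fintype.sum_eq_single (Γ.faceOf X a) hS1]
        · exact hS1 ψ hψ
      obtain ⟨k, hk, hkX⟩ := exists_nodeFun_of_even (Γ := Γ) (X := X) (f := ext y) fun g hg => by
        have h1 : ∀ d : Dart E, ext y d.1 * g d =
            ∑ ψ, (if Γ.faceOf X d = ψ then ext y d.1 else 0) * Quot.lift g hg ψ := fun d => by
          simp only [ite_mul, zero_mul, Finset.sum_ite_eq, Finset.mem_univ, if_true]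
          rfl
        rw [Finset.sum_congr rfl fun d _ => h1 d, Finset.sum_comm]
        refine Finset.sum_eq_zero fun ψ _ => ?_
        rw [← Finset.sum_mul, show ∑ d : Dart E, (if Γ.faceOf X d = ψ then ext y d.1 else 0) = 0
          from hS ψ, zero_mul]
      have hconst := hbond k hk fun e he heF => by rw [hkX e he, hext y e heF]
      refine Submodule.mem_span_singleton.2 ⟨y ⟨a.1, ha⟩, ?_⟩
      ext ⟨e, he⟩
      have := hconst a.1 ha e he
      rw [hkX _ (hFX _ ha), hkX _ (hFX _ he)] at this
      simpa [ext, ha, he] using this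
    have h1 := LinearMap.finrank_range_add_finrank_ker T
    have h2 := Submodule.finrank_mono hker
    have h3 : Module.finrank (ZMod 2) (Submodule.span (ZMod 2)
        {(fun _ => 1 : F → ZMod 2)}) ≤ 1 := by
      simpa using finrank_span_le_card (R := ZMod 2) {(fun _ => 1 : F → ZMod 2)}
    have h4 := Submodule.finrank_le (LinearMap.range T)
    rw [Module.finrank_fintype_fun_eq_card, Fintype.card_coe, Finset.card_erase_of_mem haM] at h4
    rw [Module.finrank_fintype_fun_eq_card, Fintype.card_coe] at h1
    have h5 : 0 < M.card := Finset.card_pos.2 ⟨_, haM⟩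
    omega
  have hle : ∑ ψ ∈ M, 2 = ∑ ψ ∈ M, deg ψ := by
    refine le_antisymm (Finset.sum_le_sum htwo) ?_
    rw [hsum, Finset.sum_const, smul_eq_mul]
    omega
  exact ((Finset.sum_eq_sum_iff_of_le htwo).1 hle _ haM).symm

end PlanarEmbedding

end BulkRobust

/-! ### Chords crossed by a bond -/

namespace BulkRobust

namespace PlanarEmbedding

variable {V E : Type*} {G : Multigraph V E} {Γ : PlanarEmbedding G} {X : Set E}

lemma faceOf_iterate_boundaryNext [Finite E] (l : ℕ) (d : {d : Dart E // d.1 ∈ X}) :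
    Γ.faceOf X ((Γ.boundaryNext X)^[l] d).1 = Γ.faceOf X d.1 := by
  induction l with
  | zero => rfl
  | succ l ih => rw [Function.iterate_succ_apply', faceOf_boundaryNext, ih]

/-- `pos` numbers the darts of `X` on each face in the order of the boundary walk. -/
def IsPosition [Finite E] (Γ : PlanarEmbedding G) (X : Set E)
    (pos : {d : Dart E // d.1 ∈ X} → ℕ) : Prop :=
  ∀ d d' : {d : Dart E // d.1 ∈ X}, Γ.faceOf X d.1 = Γ.faceOf X d'.1 → pos d ≤ pos d' →
    (Γ.boundaryNext X)^[pos d' - pos d] d = d' ∧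
      ∀ l ≤ pos d' - pos d, pos ((Γ.boundaryNext X)^[l] d) = pos d + l

lemma exists_isPosition [Finite E]
    (hconn : ∀ d d' : Dart E, d.1 ∈ X → d'.1 ∈ X → G.Joins X (G.tail d) (G.tail d')) :
    ∃ pos, Γ.IsPosition X pos :=
  exists_position (Γ.boundaryNext X) (fun d => Γ.faceOf X d.1) faceOf_boundaryNext
    fun _ _ h => sameCycle_boundaryNext hconn h

variable [Finite E] {pos : {d : Dart E // d.1 ∈ X} → ℕ} {F : Finset E} {c : V → ZMod 2}

open scoped Classical in
lemma side_add_side (hc : ∀ d : Dart E, d.1 ∈ X →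
    c (G.tail d) + c (G.head d) = if d.1 ∈ F then 1 else 0)
    (d : {d : Dart E // d.1 ∈ X}) (n : ℕ) :
    c (G.tail d.1) + c (G.tail ((Γ.boundaryNext X)^[n] d).1) =
      ∑ l ∈ Finset.range n, if ((Γ.boundaryNext X)^[l] d).1.1 ∈ F then 1 else 0 := by
  induction n with
  | zero => exact CharTwo.add_self_eq_zero _
  | succ n ih =>
    rw [Finset.sum_range_succ, ← ih, Function.iterate_succ_apply', tail_boundaryNext,
      ← hc _ ((Γ.boundaryNext X)^[n] d).2]
    have := CharTwo.add_self_eq_zero (c (G.tail ((Γ.boundaryNext X)^[n] d).1))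
    linear_combination -this

open scoped Classical in
lemma sum_ite_iterate_eq (hpos : Γ.IsPosition X pos) {d d' a : {d : Dart E // d.1 ∈ X}}
    (hd : Γ.faceOf X d.1 = Γ.faceOf X d'.1) (hle : pos d ≤ pos d')
    (ha : Γ.faceOf X d.1 = Γ.faceOf X a.1) :
    (∑ l ∈ Finset.range (pos d' - pos d),
      if (Γ.boundaryNext X)^[l] d = a then (1 : ZMod 2) else 0) =
      if pos d ≤ pos a ∧ pos a < pos d' then 1 else 0 := by
  split_ifs with h
  · rw [Finset.sum_eq_single (pos a - pos d), if_pos (hpos d a ha h.1).1]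
    · intro l hl hne
      refine if_neg fun hla => hne ?_
      have := (hpos d d' hd hle).2 l (Finset.mem_range.1 hl).le
      rw [hla] at this
      omega
    · exact fun hn => absurd (Finset.mem_range.2 (by omega)) hn
  · refine Finset.sum_eq_zero fun l hl => if_neg fun hla => h ?_
    have hl := Finset.mem_range.1 hl
    have := (hpos d d' hd hle).2 l hl.le
    rw [hla] at this
    omega

open scoped Classical in
/-- If `a` and `a'` are the two darts of a bond on a face, then a chord of the face joins both sides
of the bond if and only if it separates `a` from `a'`. -/
lemma side_ne_iff (hpos : Γ.IsPosition X pos) (hc : ∀ d : Dart E, d.1 ∈ X →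
    c (G.tail d) + c (G.head d) = if d.1 ∈ F then 1 else 0)
    {d d' a a' : {d : Dart E // d.1 ∈ X}} (hd : Γ.faceOf X d.1 = Γ.faceOf X d'.1)
    (hle : pos d ≤ pos d') (hne : a ≠ a') (ha : Γ.faceOf X d.1 = Γ.faceOf X a.1)
    (ha' : Γ.faceOf X d.1 = Γ.faceOf X a'.1)
    (hF : ∀ b : {d : Dart E // d.1 ∈ X}, Γ.faceOf X d.1 = Γ.faceOf X b.1 →
      (b.1.1 ∈ F ↔ b = a ∨ b = a')) :
    c (G.tail d.1) ≠ c (G.tail d'.1) ↔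
      ¬ ((pos d ≤ pos a ∧ pos a < pos d') ↔ (pos d ≤ pos a' ∧ pos a' < pos d')) := by
  have h := side_add_side (Γ := Γ) hc d (pos d' - pos d)
  have h1 : ∀ l, (if ((Γ.boundaryNext X)^[l] d).1.1 ∈ F then (1 : ZMod 2) else 0) =
      (if (Γ.boundaryNext X)^[l] d = a then 1 else 0) +
        if (Γ.boundaryNext X)^[l] d = a' then 1 else 0 := fun l => by
    have := hF _ (faceOf_iterate_boundaryNext l d).symm
    by_cases h1 : (Γ.boundaryNext X)^[l] d = a
    · simp [h1, hne, (hF a ha).2 (.inl rfl)]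
    · by_cases h2 : (Γ.boundaryNext X)^[l] d = a'
      · simp [h2, hne.symm, (hF a' ha').2 (.inr rfl)]
      · simp [h1, h2, this]
  rw [(hpos d d' hd hle).1, Finset.sum_congr rfl fun l _ => h1 l, Finset.sum_add_distrib,
    sum_ite_iterate_eq hpos hd hle ha, sum_ite_iterate_eq hpos hd hle ha'] at h
  rw [Ne, ← CharTwo.add_eq_zero, h]
  by_cases h1 : pos d ≤ pos a ∧ pos a < pos d' <;>
    by_cases h2 : pos d ≤ pos a' ∧ pos a' < pos d' <;> simp [h1, h2, CharTwo.add_self_eq_zero]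

end PlanarEmbedding

/-! ### Rounding -/

/-- A covering program has integrality gap at most two if its constraints can be ordered such that
among any columns covering a constraint `p` there are two that cover all that these columns cover
from `p` onwards. The proof is a local ratio argument: at the first constraint `p` that is not
covered at cost zero, the costs of the columns covering `p` are lowered until one of them is free. -/
theorem exists_cover_le_two_mul {J Q κ : Type*} [Fintype J] [LinearOrder κ] (pts : Finset Q)
    (r : Q → κ) (R : Q → J → Prop) [∀ q, DecidablePred (R q)]
    (hR : ∀ p ∈ pts, ∀ T : Finset J, (∀ j ∈ T, R p j) → ∃ T' ⊆ T, T'.card ≤ 2 ∧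
      ∀ q ∈ pts, r p ≤ r q → ∀ j ∈ T, R q j → ∃ j' ∈ T', R q j')
    (x : J → ℝ) (hx : ∀ j, 0 ≤ x j)
    (hcov : ∀ p ∈ pts, 1 ≤ ∑ j ∈ Finset.univ.filter (R p), x j)
    (c : J → ℝ) (hc : ∀ j, 0 ≤ c j) :
    ∃ S : Finset J, (∀ p ∈ pts, ∃ j ∈ S, R p j) ∧ ∑ j ∈ S, c j ≤ 2 * ∑ j, c j * x j := by
  classical
  induction hn : (Finset.univ.filter fun j => c j ≠ 0).card using Nat.strong_induction_on
    generalizing c with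
  | _ n ih =>
  let Z : Finset J := Finset.univ.filter fun j => c j = 0
  have hZ : ∀ j, j ∈ Z ↔ c j = 0 := fun j => by simp [Z]
  by_cases hall : ∀ p ∈ pts, ∃ j ∈ Z, R p j
  · refine ⟨Z, hall, ?_⟩
    rw [Finset.sum_eq_zero fun j hj => (hZ j).1 hj]
    have : 0 ≤ ∑ j, c j * x j := Finset.sum_nonneg fun j _ => mul_nonneg (hc j) (hx j)
    linarith
  obtain ⟨p, hp, hmin⟩ := Finset.exists_min_image (pts.filter fun p => ¬ ∃ j ∈ Z, R p j) r (by
    push Not at hall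
    obtain ⟨p, hp, h⟩ := hall
    exact ⟨p, by simpa [hp] using h⟩)
  obtain ⟨hp, hpZ⟩ := Finset.mem_filter.1 hp
  have hmin : ∀ q ∈ pts, (¬ ∃ j ∈ Z, R q j) → r p ≤ r q := fun q hq h =>
    hmin q (Finset.mem_filter.2 ⟨hq, h⟩)
  have hne : (Finset.univ.filter (R p)).Nonempty := by
    by_contra h
    have := hcov p hp
    rw [Finset.not_nonempty_iff_eq_empty.1 h, Finset.sum_empty] at this
    linarith
  obtain ⟨j₀, hj₀, hε⟩ := Finset.exists_min_image _ c hne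
  replace hj₀ : R p j₀ := by simpa using hj₀
  replace hε : ∀ j, R p j → c j₀ ≤ c j := fun j hj => hε j (by simpa using hj)
  have hj₀Z : c j₀ ≠ 0 := fun h => hpZ ⟨j₀, (hZ _).2 h, hj₀⟩
  let c' : J → ℝ := fun j => c j - if R p j then c j₀ else 0
  have hc' : ∀ j, 0 ≤ c' j := fun j => by
    by_cases h : R p j
    · simpa [c', h] using hε j h
    · simpa [c', h] using hc j
  have hZc' : ∀ j ∈ Z, c' j = 0 := fun j hj => by
    have : ¬ R p j := fun h => hpZ ⟨j, hj, h⟩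
    simpa [c', this] using (hZ j).1 hj
  obtain ⟨S', hS', hcost⟩ := ih _ (by
    rw [← hn]
    refine Finset.card_lt_card ⟨fun j hj => ?_, fun h => ?_⟩
    · simp only [Finset.mem_filter, Finset.mem_univ, true_and] at hj ⊢
      exact fun h => hj (hZc' j ((hZ j).2 h))
    · have := h (show j₀ ∈ _ by simpa using hj₀Z)
      simp [c', hj₀] at this) c' hc' rfl
  obtain ⟨T', hT', hcard, hT⟩ := hR p hp (S'.filter (R p)) fun j hj => (Finset.mem_filter.1 hj).2
  refine ⟨S'.filter (fun j => ¬ R p j) ∪ T' ∪ Z, fun q hq => ?_, ?_⟩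
  · by_cases hqZ : ∃ j ∈ Z, R q j
    · obtain ⟨j, hj, h⟩ := hqZ
      exact ⟨j, Finset.mem_union_right _ hj, h⟩
    obtain ⟨j, hj, hqj⟩ := hS' q hq
    by_cases hpj : R p j
    · obtain ⟨j', hj', h'⟩ := hT q hq (hmin q hq hqZ) j (Finset.mem_filter.2 ⟨hj, hpj⟩) hqj
      exact ⟨j', by simp [hj'], h'⟩
    · exact ⟨j, by simp [hj, hpj], hqj⟩
  · set S := S'.filter (fun j => ¬ R p j) ∪ T' ∪ Z with hS
    have hSS' : ∀ j ∈ S, j ∉ Z → j ∈ S' := fun j hj hjZ => by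
      simp only [hS, Finset.mem_union, Finset.mem_filter] at hj
      rcases hj with (hj | hj) | hj
      exacts [hj.1, (Finset.mem_filter.1 (hT' hj)).1, absurd hj hjZ]
    have hST : S.filter (R p) ⊆ T' := fun j hj => by
      simp only [hS, Finset.mem_union, Finset.mem_filter] at hj
      rcases hj with ⟨(hj | hj) | hj, h⟩
      exacts [absurd h hj.2, hj, absurd ⟨j, hj, h⟩ hpZ]
    have h1 : ∑ j ∈ S, c' j ≤ ∑ j ∈ S', c' j := by
      rw [← Finset.sum_filter_of_ne (p := fun j => j ∉ Z) fun j _ h hj => h (hZc' j hj)]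
      exact Finset.sum_le_sum_of_subset_of_nonneg
        (fun j hj => hSS' j (Finset.mem_filter.1 hj).1 (Finset.mem_filter.1 hj).2)
        fun j _ _ => hc' j
    have h2 : ∑ j ∈ S, c j = ∑ j ∈ S, c' j + (S.filter (R p)).card * c j₀ := by
      simp only [c', Finset.sum_sub_distrib, ← Finset.sum_filter, Finset.sum_const, nsmul_eq_mul]
      ring
    have h3 : ∑ j, c j * x j =
        ∑ j, c' j * x j + c j₀ * ∑ j ∈ Finset.univ.filter (R p), x j := by
      rw [Finset.mul_sum, Finset.sum_filter, ← Finset.sum_add_distrib]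
      refine Finset.sum_congr rfl fun j _ => ?_
      by_cases h : R p j <;> simp [c', h]
      ring
    have h4 : ((S.filter (R p)).card : ℝ) ≤ 2 := by
      exact_mod_cast (Finset.card_le_card hST).trans hcard
    have h5 : c j₀ * 1 ≤ c j₀ * ∑ j ∈ Finset.univ.filter (R p), x j :=
      mul_le_mul_of_nonneg_left (hcov p hp) (hc j₀)
    have h6 := mul_le_mul_of_nonneg_right h4 (hc j₀)
    rw [h2, h3]
    linarith

/-- The chord `j` lies in the face `face j` and joins the corners with positions `lo j` and `hi j` of
this face. A demand `(ψ, a, b)` is met by the chords in `ψ` that contain the dart at position `a`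
between their ends, but not the dart at position `b`. The corner at a position precedes the dart at
this position, so the darts between the ends are those in the half-open interval. -/
def Meets {J Ψ : Type*} (face : J → Ψ) (lo hi : J → ℕ) (q : Ψ × ℕ × ℕ) (j : J) : Prop :=
  face j = q.1 ∧ lo j ≤ q.2.1 ∧ q.2.1 < hi j ∧ (q.2.2 < lo j ∨ hi j ≤ q.2.2)

section Chords

variable {J Ψ : Type*} (face : J → Ψ) (lo hi : J → ℕ)

/-- The two chords among `T` that reach furthest to the left and to the right. -/
lemma exists_extreme_chords (T : Finset J) : ∃ T' ⊆ T, T'.card ≤ 2 ∧ ∀ j ∈ T,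
    (∃ j' ∈ T', lo j' ≤ lo j) ∧ ∃ j' ∈ T', hi j ≤ hi j' := by
  classical
  rcases T.eq_empty_or_nonempty with rfl | hT
  · exact ⟨∅, subset_rfl, by simp, by simp⟩
  obtain ⟨l, hl, hl'⟩ := Finset.exists_min_image T lo hT
  obtain ⟨h, hh, hh'⟩ := Finset.exists_max_image T hi hT
  exact ⟨{l, h}, by simp [Finset.insert_subset_iff, hl, hh], Finset.card_le_two,
    fun j hj => ⟨⟨l, by simp, hl' j hj⟩, h, by simp, hh' j hj⟩⟩

open scoped Classical in
/-- The demands `(ψ, a, b)` with `a < b` are processed by increasing `b`, those with `b < a` by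
decreasing `b`. -/
lemma exists_chords_le_four_mul [Fintype J] (pts : Finset (Ψ × ℕ × ℕ)) (x : J → ℝ)
    (hx : ∀ j, 0 ≤ x j)
    (hcov : ∀ q ∈ pts, 1 ≤ ∑ j ∈ Finset.univ.filter (Meets face lo hi q), x j)
    (c : J → ℝ) (hc : ∀ j, 0 ≤ c j) :
    ∃ S : Finset J, (∀ q ∈ pts, ∃ j ∈ S, Meets face lo hi q j) ∧
      ∑ j ∈ S, c j ≤ 4 * ∑ j, c j * x j := by
  obtain ⟨S₁, hS₁, hc₁⟩ := exists_cover_le_two_mul (pts.filter fun q => q.2.1 < q.2.2)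
    (fun q => q.2.2) (Meets face lo hi) (by
      rintro ⟨ψ, a, b⟩ hp T hT
      obtain ⟨T', hT', hcard, hext⟩ := exists_extreme_chords lo hi T
      refine ⟨T', hT', hcard, ?_⟩
      rintro ⟨ψ', a', b'⟩ hq hle j hj ⟨h1, h2, h3, h4⟩
      obtain ⟨⟨l, hl, hl'⟩, h, hh, hh'⟩ := hext j hj
      obtain ⟨g1, g2, g3, g4⟩ := hT j hj
      obtain ⟨l1, l2, l3, l4⟩ := hT l (hT' hl)
      obtain ⟨k1, k2, k3, k4⟩ := hT h (hT' hh)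
      have hab := (Finset.mem_filter.1 hp).2
      have hab' := (Finset.mem_filter.1 hq).2
      dsimp only at *
      rcases le_total a' a with ha | ha
      · exact ⟨l, hl, by rw [l1, ← g1, h1], by dsimp only; omega, by dsimp only; omega,
          by dsimp only; omega⟩
      · exact ⟨h, hh, by rw [k1, ← g1, h1], by dsimp only; omega, by dsimp only; omega,
          by dsimp only; omega⟩)
    x hx (fun q hq => hcov q (Finset.mem_filter.1 hq).1) c hc
  obtain ⟨S₂, hS₂, hc₂⟩ := exists_cover_le_two_mul (pts.filter fun q => ¬ q.2.1 < q.2.2)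
    (fun q => OrderDual.toDual q.2.2) (Meets face lo hi) (by
      rintro ⟨ψ, a, b⟩ hp T hT
      obtain ⟨T', hT', hcard, hext⟩ := exists_extreme_chords lo hi T
      refine ⟨T', hT', hcard, ?_⟩
      rintro ⟨ψ', a', b'⟩ hq hle j hj ⟨h1, h2, h3, h4⟩
      obtain ⟨⟨l, hl, hl'⟩, h, hh, hh'⟩ := hext j hj
      obtain ⟨g1, g2, g3, g4⟩ := hT j hj
      obtain ⟨l1, l2, l3, l4⟩ := hT l (hT' hl)
      obtain ⟨k1, k2, k3, k4⟩ := hT h (hT' hh)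
      have hab := (Finset.mem_filter.1 hp).2
      have hab' := (Finset.mem_filter.1 hq).2
      rw [OrderDual.toDual_le_toDual] at hle
      dsimp only at *
      rcases le_total a' a with ha | ha
      · exact ⟨l, hl, by rw [l1, ← g1, h1], by dsimp only; omega, by dsimp only; omega,
          by dsimp only; omega⟩
      · exact ⟨h, hh, by rw [k1, ← g1, h1], by dsimp only; omega, by dsimp only; omega,
          by dsimp only; omega⟩)
    x hx (fun q hq => hcov q (Finset.mem_filter.1 hq).1) c hc
  refine ⟨S₁ ∪ S₂, fun q hq => ?_, ?_⟩
  · by_cases h : q.2.1 < q.2.2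
    · obtain ⟨j, hj, hqj⟩ := hS₁ q (Finset.mem_filter.2 ⟨hq, h⟩)
      exact ⟨j, Finset.mem_union_left _ hj, hqj⟩
    · obtain ⟨j, hj, hqj⟩ := hS₂ q (Finset.mem_filter.2 ⟨hq, h⟩)
      exact ⟨j, Finset.mem_union_right _ hj, hqj⟩
  · have h1 := Finset.sum_union_inter (s₁ := S₁) (s₂ := S₂) (f := c)
    have h2 : 0 ≤ ∑ j ∈ S₁ ∩ S₂, c j := Finset.sum_nonneg fun j _ => hc j
    linarith

open scoped Classical in
/-- If one of at most `n` demands has to be met, then one of them is met by a `1 / n` fraction. -/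
lemma exists_chords_le_mul [Fintype J] {Φ : Type*} (Ω : Finset Φ) (N : Φ → Finset (Ψ × ℕ × ℕ))
    (n : ℕ) (hN : ∀ F ∈ Ω, (N F).card ≤ n) (x : J → ℝ) (hx : ∀ j, 0 ≤ x j)
    (hcov : ∀ F ∈ Ω,
      1 ≤ ∑ j ∈ Finset.univ.filter (fun j => ∃ q ∈ N F, Meets face lo hi q j), x j)
    (c : J → ℝ) (hc : ∀ j, 0 ≤ c j) :
    ∃ S : Finset J, (∀ F ∈ Ω, ∃ j ∈ S, ∃ q ∈ N F, Meets face lo hi q j) ∧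
      ∑ j ∈ S, c j ≤ 4 * n * ∑ j, c j * x j := by
  have hex : ∀ F : Ω, ∃ q ∈ N F.1,
      1 ≤ ∑ j ∈ Finset.univ.filter (Meets face lo hi q), n * x j := by
    rintro ⟨F, hF⟩
    by_contra! hlt
    have h1 : ∑ j ∈ Finset.univ.filter (fun j => ∃ q ∈ N F, Meets face lo hi q j), x j ≤
        ∑ q ∈ N F, ∑ j ∈ Finset.univ.filter (Meets face lo hi q), x j := by
      simp only [Finset.sum_filter]
      rw [Finset.sum_comm]
      refine Finset.sum_le_sum fun j _ => ?_
      have h0 : ∀ q ∈ N F, 0 ≤ if Meets face lo hi q j then x j else 0 := fun q _ => by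
        split_ifs
        exacts [hx j, le_rfl]
      split_ifs with h
      · obtain ⟨q, hq, hj⟩ := h
        refine le_trans (by rw [if_pos hj]) (Finset.single_le_sum h0 hq)
      · exact Finset.sum_nonneg h0
    have h2 := (hcov F hF).trans h1
    have hpos : 0 < (N F).card := by
      rw [Finset.card_pos]
      by_contra h
      rw [Finset.not_nonempty_iff_eq_empty.1 h, Finset.sum_empty] at h2
      linarith
    have h3 := Finset.sum_lt_sum_of_nonempty (Finset.card_pos.1 hpos) hlt
    simp only [← Finset.mul_sum, Finset.sum_const, nsmul_eq_mul, mul_one] at h3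
    have h4 : (n : ℝ) * 1 ≤ n * ∑ q ∈ N F, ∑ j ∈ Finset.univ.filter (Meets face lo hi q), x j :=
      mul_le_mul_of_nonneg_left h2 n.cast_nonneg
    have h5 : ((N F).card : ℝ) ≤ n := by exact_mod_cast hN F hF
    linarith
  choose q hq hq' using hex
  obtain ⟨S, hS, hcost⟩ := exists_chords_le_four_mul face lo hi (Finset.univ.image q)
    (fun j => n * x j) (fun j => mul_nonneg n.cast_nonneg (hx j)) (by
      intro q' hq''
      obtain ⟨F, -, rfl⟩ := Finset.mem_image.1 hq''
      exact hq' F) c hc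
  refine ⟨S, fun F hF => ?_, hcost.trans (le_of_eq ?_)⟩
  · obtain ⟨j, hj, h⟩ := hS (q ⟨F, hF⟩) (Finset.mem_image_of_mem _ (Finset.mem_univ _))
    exact ⟨j, hj, _, hq _, h⟩
  · rw [mul_assoc, Finset.mul_sum _ _ (n : ℝ)]
    congr 1
    exact Finset.sum_congr rfl fun j _ => by ring

end Chords

end BulkRobust

/-! ### Splitting links into chords -/

namespace BulkRobust

namespace Multigraph

variable {V E : Type*} {G : Multigraph V E} {A : Set E} {u v : V}

lemma IsWalk.reverse {p : List (Dart E)} (hp : G.IsWalk A u p v) :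
    G.IsWalk A v (p.reverse.map flip) u := by
  induction p generalizing u with
  | nil => exact Eq.symm hp
  | cons d p ih =>
    rw [List.reverse_cons, List.map_append]
    exact (ih hp.2.2).append ⟨hp.1, rfl, by simpa [IsWalk] using hp.2.1⟩

end Multigraph

lemma pathWeight_append {E : Type*} (w : E → ℕ) (p q : List (Dart E)) :
    pathWeight w (p ++ q) = pathWeight w p + pathWeight w q := by
  simp [pathWeight]

lemma pathWeight_reverse {E : Type*} (w : E → ℕ) (p : List (Dart E)) :
    pathWeight w (p.reverse.map flip) = pathWeight w p := by
  simp [pathWeight, List.sum_reverse, Function.comp_def]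

lemma pathWeight_le_of_sublist {E : Type*} (w : E → ℕ) {p q : List (Dart E)} (h : p.Sublist q) :
    pathWeight w p ≤ pathWeight w q :=
  (h.map _).sum_le_sum fun _ _ => Nat.zero_le _

/-- A shortest path is no longer than any walk with the same ends, in either direction. -/
lemma Multigraph.IsShortestPath.pathWeight_le {V E : Type*} {G : Multigraph V E} {w : E → ℕ}
    {A : Set E} {u v a b : V} {p q : List (Dart E)} (hp : G.IsShortestPath w A u p v)
    (hq : G.IsWalk A a q b) (h : s(u, v) = s(a, b)) : pathWeight w p ≤ pathWeight w q := by
  rcases Sym2.eq_iff.1 h with ⟨rfl, rfl⟩ | ⟨rfl, rfl⟩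
  · obtain ⟨q', hq', hs⟩ := hq.exists_isPath
    exact (hp.2 q' hq').trans (pathWeight_le_of_sublist w hs)
  · obtain ⟨q', hq', hs⟩ := hq.reverse.exists_isPath
    exact (hp.2 q' hq').trans ((pathWeight_le_of_sublist w hs).trans_eq (pathWeight_reverse w q))

namespace PlanarEmbedding

variable {V E : Type*} [Finite E] {G : Multigraph V E} {Γ : PlanarEmbedding G} {X : Set E}

/-- Away from the nodes of `X` a walk does not change the face. -/
lemma faceOf_eq_of_tail_eq {d d' : Dart E} (h : G.tail d = G.tail d')
    (hd : G.tail d ∉ G.nodesOf X) : Γ.faceOf X d = Γ.faceOf X d' := by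
  obtain ⟨k, rfl⟩ := exists_iterate_rot_eq (Γ := Γ) h
  clear h
  have ht : ∀ k, G.tail (Γ.rot^[k] d) = G.tail d := fun k => by
    induction k with
    | zero => rfl
    | succ k ih => rw [Function.iterate_succ_apply', tail_rot, ih]
  induction k with
  | zero => rfl
  | succ k ih =>
    rw [Function.iterate_succ_apply', faceOf_rot, ih]
    exact fun hX => hd (ht k ▸ Multigraph.tail_mem_nodesOf hX)

/-- Following a walk outside `X` until it meets a node of `X` for the next time. -/
lemma exists_first_return {p : List (Dart E)} {d : Dart E} {v : V}
    (hp : G.IsWalk Xᶜ (G.tail d) (d :: p) v) (hv : v ∈ G.nodesOf X) :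
    ∃ p₁ p₂ e, d :: p = p₁ ++ p₂ ∧ p₂.length < (d :: p).length ∧
      G.IsWalk Xᶜ (G.tail d) p₁ (G.head e) ∧ e.1 ∉ X ∧ Γ.faceOf X e = Γ.faceOf X d ∧
      G.head e ∈ G.nodesOf X ∧ G.IsWalk Xᶜ (G.head e) p₂ v := by
  induction p generalizing d with
  | nil =>
    obtain ⟨hd, -, rfl⟩ := hp
    exact ⟨[d], [], d, rfl, by simp, ⟨hd, rfl, rfl⟩, hd, rfl, hv, rfl⟩
  | cons d' p ih =>
    obtain ⟨hd, -, hp⟩ := hp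
    by_cases hn : G.head d ∈ G.nodesOf X
    · exact ⟨[d], d' :: p, d, rfl, by simp, ⟨hd, rfl, rfl⟩, hd, rfl, hn, hp⟩
    · have ht : G.tail d' = G.head d := hp.2.1
      obtain ⟨p₁, p₂, e, h1, h2, h3, h4, h5, h6, h7⟩ := ih (d := d') (by rwa [ht])
      refine ⟨d :: p₁, p₂, e, by rw [h1, List.cons_append], h2.trans (by simp),
        ⟨hd, rfl, by rwa [← ht]⟩, h4, ?_, h6, h7⟩
      rw [h5, ← faceOf_flip hd]
      exact (faceOf_eq_of_tail_eq (d := flip d) ht.symm hn).symm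

/-- A link is a concatenation of chords: walks outside `X` between two corners of one face of `X`.
A chord is recorded as its weight and its two corners. A bond that separates the ends of the link
separates the ends of one of the chords. -/
lemma exists_chords (w : E → ℕ) {p : List (Dart E)} {u v : V} (hp : G.IsWalk Xᶜ u p v)
    (hu : u ∈ G.nodesOf X) (hv : v ∈ G.nodesOf X) :
    ∃ C : List (ℕ × {d : Dart E // d.1 ∈ X} × {d : Dart E // d.1 ∈ X}),
      (∀ z ∈ C, Γ.faceOf X z.2.1.1 = Γ.faceOf X z.2.2.1 ∧
        ∃ q, G.IsWalk Xᶜ (G.tail z.2.1.1) q (G.tail z.2.2.1) ∧ pathWeight w q = z.1) ∧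
      (C.map Prod.fst).sum ≤ pathWeight w p ∧
      ∀ c : V → ZMod 2, c u ≠ c v → ∃ z ∈ C, c (G.tail z.2.1.1) ≠ c (G.tail z.2.2.1) := by
  induction hn : p.length using Nat.strong_induction_on generalizing p u with
  | _ n ih =>
  rcases p with _ | ⟨d, p⟩
  · obtain rfl : u = v := hp
    exact ⟨[], by simp, by simp, fun c h => absurd rfl h⟩
  obtain rfl : G.tail d = u := hp.2.1
  obtain ⟨p₁, p₂, e, h1, h2, h3, h4, h5, h6, h7⟩ := exists_first_return (Γ := Γ) hp hv
  obtain ⟨C, hC1, hC2, hC3⟩ := ih _ (hn ▸ h2) h7 h6 rfl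
  refine ⟨(pathWeight w p₁, ⟨Γ.corner X d, corner_mem hu⟩,
    ⟨Γ.corner X (flip e), corner_mem h6⟩) :: C, ?_, ?_, fun c hc => ?_⟩
  · rintro z hz
    rcases List.mem_cons.1 hz with rfl | hz
    · refine ⟨?_, p₁, ?_, rfl⟩
      · rw [faceOf_corner, faceOf_corner, faceOf_flip h4, h5]
      · rwa [tail_corner, tail_corner, Multigraph.tail_flip]
    · exact hC1 z hz
  · rw [h1, pathWeight_append, List.map_cons, List.sum_cons]
    omega
  · by_cases h : c (G.tail d) = c (G.head e)
    · obtain ⟨z, hz, h'⟩ := hC3 c (h ▸ hc)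
      exact ⟨z, List.mem_cons_of_mem _ hz, h'⟩
    · refine ⟨_, List.mem_cons_self, ?_⟩
      rwa [tail_corner, tail_corner, Multigraph.tail_flip]

end PlanarEmbedding

end BulkRobust

/-! ### Relevant failure sets are bonds -/

namespace BulkRobust

namespace Problem

variable {V E : Type*} {P : Problem V E} {i : ℕ} {X : Set E} {F : Finset E}

/-- Feasibility for the previous level makes a relevant failure set a minimal cut. -/
lemma exists_dart_of_mem_relevant (hX : P.LevelFeasible (i - 1) X) (hF : F ∈ P.Relevant i X)
    {e : E} (he : e ∈ F) : e ∈ X ∧ P.graph.Joins X P.s P.t ∧ ∃ d : Dart E, d.1 = e ∧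
      P.graph.Joins (X \ ↑F) P.s (P.graph.tail d) ∧
        P.graph.Joins (X \ ↑F) (P.graph.head d) P.t := by
  classical
  obtain ⟨⟨⟨j, hj⟩, hcard⟩, hn⟩ := hF
  have h := hX (F.erase e) ⟨⟨j, (F.erase_subset e).trans hj⟩, by
    rw [Finset.card_erase_of_mem he]
    omega⟩
  have hsub : X \ ↑(F.erase e) ⊆ insert e (X \ ↑F) := fun a ha => by
    by_cases hae : a = e
    · exact .inl hae
    · exact .inr ⟨ha.1, fun haF => ha.2 (Finset.mem_erase.2 ⟨hae, haF⟩)⟩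
  refine ⟨by_contra fun heX => hn (h.mono fun a ha => ?_), h.mono Set.sdiff_subset,
    (h.mono hsub).exists_dart_of_insert hn⟩
  exact (hsub ha).resolve_left fun hae => heX (hae ▸ ha.1)

lemma eq_or_eq_flip {d d' : Dart E} (h : d.1 = d'.1) : d = d' ∨ d = flip d' := by
  obtain ⟨e, b⟩ := d
  obtain ⟨e', b'⟩ := d'
  obtain rfl : e = e' := h
  rcases Bool.eq_or_eq_not b b' with rfl | rfl
  exacts [.inl rfl, .inr rfl]

lemma not_joins_of_mem_relevant (hF : F ∈ P.Relevant i X) {v : V}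
    (hs : P.graph.Joins (X \ ↑F) P.s v) : ¬ P.graph.Joins (X \ ↑F) P.t v :=
  fun ht => hF.2 (hs.trans ht.symm)

lemma joins_s_or_joins_t (hX : P.LevelFeasible (i - 1) X) (hF : F ∈ P.Relevant i X) {v : V}
    (hv : P.graph.Joins X P.s v) :
    P.graph.Joins (X \ ↑F) P.s v ∨ P.graph.Joins (X \ ↑F) P.t v := by
  refine hv.induction
    (motive := fun v => P.graph.Joins (X \ ↑F) P.s v ∨ P.graph.Joins (X \ ↑F) P.t v)
    (.inl (.refl _)) fun d hd ih => ?_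
  by_cases hdF : d.1 ∈ F
  · obtain ⟨-, -, d', hd', hs, ht⟩ := exists_dart_of_mem_relevant hX hF hdF
    rcases eq_or_eq_flip hd'.symm with rfl | rfl
    · exact .inr ht.symm
    · exact .inl (by rwa [Multigraph.head_flip])
  · have h := Multigraph.joins_tail_head (G := P.graph) (A := X \ ↑F) (d := d) ⟨hd, hdF⟩
    exact ih.imp (·.trans h) (·.trans h)

lemma joins_of_mem_nodesOf (hX : P.LevelFeasible (i - 1) X)
    (hrel : ∀ e ∈ X, ∃ F ∈ P.Relevant i X, e ∈ F) {v : V} (hv : v ∈ P.graph.nodesOf X) :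
    P.graph.Joins X P.s v := by
  obtain ⟨d, hd, rfl⟩ := hv
  obtain ⟨F, hF, hdF⟩ := hrel _ hd
  obtain ⟨-, hst, d', hd', hs, ht⟩ := exists_dart_of_mem_relevant hX hF hdF
  rcases eq_or_eq_flip hd'.symm with rfl | rfl
  · exact hs.mono Set.sdiff_subset
  · exact hst.trans (ht.mono Set.sdiff_subset).symm

open scoped Classical in
/-- The side of the cut `F` on which a node lies: `1` on the side of `s` and `0` elsewhere. -/
noncomputable def side (P : Problem V E) (X : Set E) (F : Finset E) (v : V) : ZMod 2 :=
  if P.graph.Joins (X \ ↑F) P.s v then 1 else 0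

lemma side_eq_one (h : P.graph.Joins (X \ ↑F) P.s v) : P.side X F v = 1 := if_pos h

lemma side_eq_zero (hF : F ∈ P.Relevant i X) {v : V} (h : P.graph.Joins (X \ ↑F) P.t v) :
    P.side X F v = 0 :=
  if_neg fun hs => not_joins_of_mem_relevant hF hs h

open scoped Classical in
lemma side_tail_add_side_head (hX : P.LevelFeasible (i - 1) X) (hF : F ∈ P.Relevant i X)
    (d : Dart E) (hd : d.1 ∈ X) :
    P.side X F (P.graph.tail d) + P.side X F (P.graph.head d) = if d.1 ∈ F then 1 else 0 := by
  split_ifs with hdF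
  · obtain ⟨-, -, d', hd', hs, ht⟩ := exists_dart_of_mem_relevant hX hF hdF
    rcases eq_or_eq_flip hd'.symm with rfl | rfl
    · rw [side_eq_one hs, side_eq_zero hF ht.symm, add_zero]
    · rw [Multigraph.tail_flip, Multigraph.head_flip, side_eq_one hs, side_eq_zero hF ht.symm,
        zero_add]
  · have h : P.graph.Joins (X \ ↑F) P.s (P.graph.tail d) ↔
        P.graph.Joins (X \ ↑F) P.s (P.graph.head d) :=
      ⟨fun h => h.trans (Multigraph.joins_tail_head ⟨hd, hdF⟩),
        fun h => h.trans (Multigraph.joins_head_tail ⟨hd, hdF⟩)⟩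
    simp only [side, h, CharTwo.add_self_eq_zero]

lemma apply_eq_of_joins {G : Multigraph V E} {Γ : PlanarEmbedding G} {A : Set E}
    {k : Dart E → ZMod 2} (hk : k ∈ Γ.nodeFun) (hA : ∀ e ∈ A, edgeSum E k e = 0) {d d' : Dart E}
    (h : G.Joins A (G.tail d) (G.tail d')) : k d = k d' := by
  refine h.induction (motive := fun v => ∀ a, G.tail a = v → k d = k a)
    (fun a ha => PlanarEmbedding.apply_eq_of_mem_nodeFun hk ha.symm) (fun b hb ih a ha => ?_) d' rfl
  rw [ih b rfl, eq_of_edgeSum_eq_zero (hA _ hb)]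
  exact PlanarEmbedding.apply_eq_of_mem_nodeFun hk ha.symm

/-- On each face which it meets, a relevant failure set has precisely two darts. -/
lemma exists_mate [Finite E] (Γ : PlanarEmbedding P.graph) (hX : P.LevelFeasible (i - 1) X)
    (hF : F ∈ P.Relevant i X) (a : {d : Dart E // d.1 ∈ X}) (ha : a.1.1 ∈ F) :
    ∃ a' : {d : Dart E // d.1 ∈ X}, a ≠ a' ∧ Γ.faceOf X a.1 = Γ.faceOf X a'.1 ∧
      ∀ b : {d : Dart E // d.1 ∈ X}, Γ.faceOf X a.1 = Γ.faceOf X b.1 →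
        (b.1.1 ∈ F ↔ b = a ∨ b = a') := by
  classical
  have := Fintype.ofFinite E
  have hcard := PlanarEmbedding.card_face_darts (Γ := Γ) (X := X) (F := F)
    (fun e he => (exists_dart_of_mem_relevant hX hF he).1)
    (side_tail_add_side_head hX hF) (fun k hk hkX e he e' he' => by
      obtain ⟨-, -, d, rfl, hs, ht⟩ := exists_dart_of_mem_relevant hX hF he
      obtain ⟨-, -, d', rfl, hs', ht'⟩ := exists_dart_of_mem_relevant hX hF he'
      have hA : ∀ e ∈ X \ ↑F, edgeSum E k e = 0 := fun e he => hkX e he.1 he.2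
      rw [edgeSum_apply, edgeSum_apply, apply_eq_of_joins hk hA (hs.symm.trans hs'),
        apply_eq_of_joins hk hA (d := flip d) (d' := flip d') (ht.trans ht'.symm)]) a.1 ha
  have haf : a.1 ∈ Finset.univ.filter fun d : Dart E =>
      d.1 ∈ F ∧ Γ.faceOf X d = Γ.faceOf X a.1 := by simp [ha]
  obtain ⟨a', ha'⟩ := Finset.card_eq_one.1
    ((Finset.card_erase_of_mem haf).trans (by rw [hcard]))
  have hmem : ∀ b : Dart E, Γ.faceOf X a.1 = Γ.faceOf X b → (b.1 ∈ F ↔ b = a.1 ∨ b = a') := by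
    intro b hb
    have := congrArg (b ∈ ·) ha'
    simp only [Finset.mem_erase, Finset.mem_filter, Finset.mem_univ, true_and,
      Finset.mem_singleton, eq_iff_iff, hb, and_true] at this
    by_cases hba : b = a.1
    · simp [hba, ha]
    · simp [hba, ← this]
  have ha'' : a' ∈ (Finset.univ.filter fun d : Dart E =>
      d.1 ∈ F ∧ Γ.faceOf X d = Γ.faceOf X a.1).erase a.1 := by
    rw [ha']
    exact Finset.mem_singleton_self _
  simp only [Finset.mem_erase, Finset.mem_filter, Finset.mem_univ, true_and] at ha''
  obtain ⟨hne, haF, hface⟩ := ha''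
  refine ⟨⟨a', (exists_dart_of_mem_relevant hX hF haF).1⟩,
    fun h => hne (Subtype.ext_iff.1 h).symm, hface.symm, fun b hb => ?_⟩
  rw [hmem b.1 hb, Subtype.ext_iff, Subtype.ext_iff]

/-! ### Rounding a fractional link cover -/

open scoped Classical in
/-- A fractional link cover can be rounded at the expense of a factor `8 * i`. -/
theorem exists_isLinkCover_le [Fintype V] [Fintype E] (Γ : PlanarEmbedding P.graph)
    (hX : P.LevelFeasible (i - 1) X) (hrel : ∀ e ∈ X, ∃ F ∈ P.Relevant i X, e ∈ F)
    {L : Sym2 V → List (Dart E)} (hL : P.IsLinkSystem X L) {x : Sym2 V → ℝ}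
    (hx : P.LPFeasible i X x) :
    ∃ S : Finset (Sym2 V), P.IsLinkCover i X S ∧
      (P.linkCost L S : ℝ) ≤ 8 * i * P.lpCost X L x := by
  have hconn : ∀ d d' : Dart E, d.1 ∈ X → d'.1 ∈ X →
      P.graph.Joins X (P.graph.tail d) (P.graph.tail d') := fun d d' hd hd' =>
    (joins_of_mem_nodesOf hX hrel (Multigraph.tail_mem_nodesOf hd)).symm.trans
      (joins_of_mem_nodesOf hX hrel (Multigraph.tail_mem_nodesOf hd'))
  obtain ⟨pos, hpos⟩ := PlanarEmbedding.exists_isPosition (Γ := Γ) hconn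
  have hchords : ∀ e : P.linkPairs X,
      ∃ C : List (ℕ × {d : Dart E // d.1 ∈ X} × {d : Dart E // d.1 ∈ X}),
        (∀ z ∈ C, Γ.faceOf X z.2.1.1 = Γ.faceOf X z.2.2.1 ∧
          ∃ q, P.graph.IsWalk Xᶜ (P.graph.tail z.2.1.1) q (P.graph.tail z.2.2.1) ∧
            pathWeight P.w q = z.1) ∧
        (C.map Prod.fst).sum ≤ pathWeight P.w (L e) ∧
        ∀ F ∈ P.Relevant i X, P.Covers X F e →
          ∃ z ∈ C, P.side X F (P.graph.tail z.2.1.1) ≠ P.side X F (P.graph.tail z.2.2.1) := by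
    rintro ⟨e, he⟩
    obtain ⟨u, v, rfl, hp⟩ := hL e he
    obtain ⟨u', v', huv, -, hu, hv, -⟩ := (Finset.mem_filter.1 he).2
    have huv' : u ∈ P.graph.nodesOf X ∧ v ∈ P.graph.nodesOf X := by
      rcases Sym2.eq_iff.1 huv with ⟨rfl, rfl⟩ | ⟨rfl, rfl⟩
      exacts [⟨hu, hv⟩, ⟨hv, hu⟩]
    obtain ⟨C, h1, h2, h3⟩ :=
      PlanarEmbedding.exists_chords (Γ := Γ) P.w hp.1.1 huv'.1 huv'.2
    refine ⟨C, h1, h2, fun F hF hcov => h3 _ ?_⟩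
    obtain ⟨a, b, hab, hs, ht⟩ := hcov
    rcases Sym2.eq_iff.1 hab with ⟨rfl, rfl⟩ | ⟨rfl, rfl⟩
    · rw [side_eq_one hs, side_eq_zero hF ht]
      exact one_ne_zero
    · rw [side_eq_one hs, side_eq_zero hF ht]
      exact zero_ne_one
  choose C hC hCw hCcov using hchords
  let J := (e : P.linkPairs X) × Fin (C e).length
  let p : J → {d : Dart E // d.1 ∈ X} := fun j => ((C j.1)[j.2]).2.1
  let q : J → {d : Dart E // d.1 ∈ X} := fun j => ((C j.1)[j.2]).2.2
  let c : J → ℝ := fun j => ((C j.1)[j.2]).1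
  have hface : ∀ j, Γ.faceOf X (p j).1 = Γ.faceOf X (q j).1 := fun j =>
    (hC j.1 _ (List.getElem_mem _)).1
  have hmate : ∀ F a, ∃ a' : {d : Dart E // d.1 ∈ X}, F ∈ P.Relevant i X → a.1.1 ∈ F →
      a ≠ a' ∧ Γ.faceOf X a.1 = Γ.faceOf X a'.1 ∧
      ∀ b : {d : Dart E // d.1 ∈ X}, Γ.faceOf X a.1 = Γ.faceOf X b.1 →
        (b.1.1 ∈ F ↔ b = a ∨ b = a') := by
    intro F a
    by_cases h : F ∈ P.Relevant i X ∧ a.1.1 ∈ F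
    · obtain ⟨a', h'⟩ := exists_mate Γ hX h.1 a h.2
      exact ⟨a', fun _ _ => h'⟩
    · exact ⟨a, fun h1 h2 => absurd ⟨h1, h2⟩ h⟩
  choose mate hmate using hmate
  let N : Finset E → Finset (Γ.Face X × ℕ × ℕ) := fun F =>
    (Finset.univ.filter fun a : {d : Dart E // d.1 ∈ X} => a.1.1 ∈ F).image
      fun a => (Γ.faceOf X a.1, pos a, pos (mate F a))
  let R : Finset E → J → Prop := fun F j => ∃ r ∈ N F,
    Meets (fun j => Γ.faceOf X (p j).1) (fun j => min (pos (p j)) (pos (q j)))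
      (fun j => max (pos (p j)) (pos (q j))) r j
  -- a chord joins the two sides of `F` if and only if it separates a dart of `F` from its mate
  have hR : ∀ F ∈ P.Relevant i X, ∀ j, R F j ↔
      P.side X F (P.graph.tail (p j).1) ≠ P.side X F (P.graph.tail (q j).1) := by
    intro F hF j
    have hside := side_tail_add_side_head (P := P) hX hF
    -- the chord with its ends in the order of their positions
    obtain ⟨d, d', hdd, hle, hdp, hlo, hhi, hs⟩ : ∃ d d' : {d : Dart E // d.1 ∈ X},
        Γ.faceOf X d.1 = Γ.faceOf X d'.1 ∧ pos d ≤ pos d' ∧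
        Γ.faceOf X d.1 = Γ.faceOf X (p j).1 ∧ min (pos (p j)) (pos (q j)) = pos d ∧
        max (pos (p j)) (pos (q j)) = pos d' ∧
        (P.side X F (P.graph.tail (p j).1) ≠ P.side X F (P.graph.tail (q j).1) ↔
          P.side X F (P.graph.tail d.1) ≠ P.side X F (P.graph.tail d'.1)) := by
      rcases le_total (pos (p j)) (pos (q j)) with h | h
      · exact ⟨p j, q j, hface j, h, rfl, min_eq_left h, max_eq_right h, Iff.rfl⟩
      · exact ⟨q j, p j, (hface j).symm, h, (hface j).symm, min_eq_right h, max_eq_left h, ne_comm⟩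
    rw [hs]
    constructor
    · rintro ⟨r, hr, h1, h2, h3, h4⟩
      obtain ⟨a, ha, rfl⟩ := Finset.mem_image.1 hr
      obtain ⟨m1, m2, m3⟩ := hmate F a hF (Finset.mem_filter.1 ha).2
      have hda : Γ.faceOf X d.1 = Γ.faceOf X a.1 := hdp.trans h1
      rw [PlanarEmbedding.side_ne_iff hpos hside hdd hle m1 hda (hda.trans m2)
        fun b hb => m3 b (hda.symm.trans hb)]
      dsimp only at h2 h3 h4
      rw [hlo] at h2 h4
      rw [hhi] at h3 h4
      omega
    · intro hne
      have h := PlanarEmbedding.side_add_side (Γ := Γ) hside d (pos d' - pos d)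
      rw [(hpos d d' hdd hle).1] at h
      -- some dart of `F` lies between the ends of the chord
      obtain ⟨l, hl, hlF⟩ : ∃ l ∈ Finset.range (pos d' - pos d),
          ((Γ.boundaryNext X)^[l] d).1.1 ∈ F := by
        by_contra! hall
        rw [Finset.sum_eq_zero fun l hl => if_neg (hall l hl)] at h
        exact hne (CharTwo.add_eq_zero.1 h)
      set a := (Γ.boundaryNext X)^[l] d with ha
      have hda : Γ.faceOf X d.1 = Γ.faceOf X a.1 :=
        (PlanarEmbedding.faceOf_iterate_boundaryNext l d).symm
      obtain ⟨m1, m2, m3⟩ := hmate F a hF hlF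
      rw [PlanarEmbedding.side_ne_iff hpos hside hdd hle m1 hda (hda.trans m2)
        fun b hb => m3 b (hda.symm.trans hb)] at hne
      have hl := Finset.mem_range.1 hl
      have hposa := (hpos d d' hdd hle).2 l hl.le
      rw [← ha] at hposa
      refine ⟨_, Finset.mem_image_of_mem _ (Finset.mem_filter.2 ⟨Finset.mem_univ _, hlF⟩),
        hdp.symm.trans hda, ?_, ?_, ?_⟩ <;> dsimp only <;> (try rw [hlo]) <;> (try rw [hhi]) <;>
        omega
  have hNcard : ∀ F ∈ (Set.toFinite (P.Relevant i X)).toFinset, (N F).card ≤ 2 * i := by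
    intro F hF
    have hF : F ∈ P.Relevant i X := by simpa using hF
    have h1 : (Finset.univ.filter fun a : {d : Dart E // d.1 ∈ X} => a.1.1 ∈ F).card ≤
        (F ×ˢ (Finset.univ : Finset Bool)).card :=
      Finset.card_le_card_of_injOn Subtype.val
        (fun a ha => by simpa using ha) Subtype.val_injective.injOn
    rw [Finset.card_product, Finset.card_univ, Fintype.card_bool] at h1
    have := hF.1.2
    have h2 : (N F).card ≤ _ := Finset.card_image_le
    omega
  have hx0 : ∀ j : J, 0 ≤ x j.1 := fun j => hx.1 _ j.1.2
  obtain ⟨S, hS, hcost⟩ := exists_chords_le_mul (fun j => Γ.faceOf X (p j).1)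
    (fun j => min (pos (p j)) (pos (q j))) (fun j => max (pos (p j)) (pos (q j)))
    (Set.toFinite (P.Relevant i X)).toFinset N (2 * i) hNcard (fun j : J => x j.1) hx0
    (fun F hF => by
      have hF : F ∈ P.Relevant i X := by simpa using hF
      refine (hx.2 F hF).trans ?_
      have h1 : ∀ e ∈ (P.linkPairs X).filter (fun e => P.Covers X F e),
          ∃ j : J, j.1.1 = e ∧ R F j := fun e he => by
        obtain ⟨he, hcov⟩ := Finset.mem_filter.1 he
        obtain ⟨z, hz, h⟩ := hCcov ⟨e, he⟩ F hF hcov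
        obtain ⟨k, hk, rfl⟩ := List.getElem_of_mem hz
        exact ⟨⟨⟨e, he⟩, ⟨k, hk⟩⟩, rfl, (hR F hF _).2 h⟩
      choose f hf hfR using h1
      rw [← Finset.sum_coe_sort,
        Finset.sum_congr rfl fun e _ => congrArg x (hf e.1 e.2).symm,
        ← Finset.sum_image (f := fun j : J => x j.1) (g := fun e => f e.1 e.2)
          fun e _ e' _ h => Subtype.ext (by rw [← hf e.1 e.2, ← hf e'.1 e'.2]; exact congrArg (fun j : J => j.1.1) h)]
      refine Finset.sum_le_sum_of_subset_of_nonneg (fun j hj => ?_) fun j _ _ => hx0 j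
      obtain ⟨e, -, rfl⟩ := Finset.mem_image.1 hj
      exact Finset.mem_filter.2 ⟨Finset.mem_univ _, hfR e.1 e.2⟩)
    c (fun j => Nat.cast_nonneg _)
  -- chords whose ends coincide cover nothing and name no link
  let S' := S.filter fun j => P.graph.tail (p j).1 ≠ P.graph.tail (q j).1
  let g : J → Sym2 V := fun j => s(P.graph.tail (p j).1, P.graph.tail (q j).1)
  have hwalk : ∀ j : J, ∃ r, P.graph.IsWalk Xᶜ (P.graph.tail (p j).1) r (P.graph.tail (q j).1) ∧
      (pathWeight P.w r : ℝ) = c j := fun j => by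
    obtain ⟨r, hr, h⟩ := (hC j.1 _ (List.getElem_mem _)).2
    exact ⟨r, hr, by rw [h]; rfl⟩
  have hlink : ∀ j ∈ S', g j ∈ P.linkPairs X := fun j hj => by
    obtain ⟨r, hr, -⟩ := hwalk j
    exact Finset.mem_filter.2 ⟨Finset.mem_univ _, _, _, rfl, (Finset.mem_filter.1 hj).2,
      Multigraph.tail_mem_nodesOf (p j).2, Multigraph.tail_mem_nodesOf (q j).2, hr.joins⟩
  refine ⟨S'.image g, ⟨fun e he => ?_, fun F hF => ?_⟩, ?_⟩
  · obtain ⟨j, hj, rfl⟩ := Finset.mem_image.1 he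
    exact hlink j hj
  · obtain ⟨j, hj, h⟩ := hS F (by simpa using hF)
    replace h := (hR F hF j).1 h
    refine ⟨g j, Finset.mem_image_of_mem _ (Finset.mem_filter.2 ⟨hj, fun h' => h (by rw [h'])⟩), ?_⟩
    have hor : ∀ a : {d : Dart E // d.1 ∈ X}, _ := fun a =>
      joins_s_or_joins_t hX hF (joins_of_mem_nodesOf hX hrel (Multigraph.tail_mem_nodesOf a.2))
    rcases hor (p j) with h1 | h1 <;> rcases hor (q j) with h2 | h2
    · exact absurd ((side_eq_one h1).trans (side_eq_one h2).symm) h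
    · exact ⟨_, _, rfl, h1, h2⟩
    · exact ⟨_, _, Sym2.eq_swap, h2, h1⟩
    · exact absurd ((side_eq_zero hF h1).trans (side_eq_zero hF h2).symm) h
  · have h1 : (P.linkCost L (S'.image g) : ℝ) ≤ ∑ j ∈ S, c j := by
      have h2 : P.linkCost L (S'.image g) ≤ ∑ j ∈ S', pathWeight P.w (L (g j)) :=
        Finset.sum_image_le_of_nonneg fun _ _ => Nat.zero_le _
      have h3 : ((∑ j ∈ S', pathWeight P.w (L (g j)) : ℕ) : ℝ) ≤ ∑ j ∈ S', c j := by
        rw [Nat.cast_sum]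
        refine Finset.sum_le_sum fun j hj => ?_
        obtain ⟨r, hr, hw⟩ := hwalk j
        obtain ⟨u, v, huv, hp⟩ := hL _ (hlink j hj)
        rw [← hw]
        exact_mod_cast hp.pathWeight_le hr huv.symm
      exact ((Nat.cast_le (α := ℝ)).2 h2).trans (h3.trans
        (Finset.sum_le_sum_of_subset_of_nonneg (Finset.filter_subset _ _)
          fun _ _ _ => Nat.cast_nonneg _))
    have h2 : ∑ j : J, c j * x j.1 ≤ P.lpCost X L x := by
      rw [Fintype.sum_sigma, lpCost, ← Finset.sum_coe_sort (P.linkPairs X) fun e => (pathWeight P.w (L e) : ℝ) * x e]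
      refine Finset.sum_le_sum fun e _ => ?_
      rw [← Finset.sum_mul _ _ (x e)]
      refine mul_le_mul_of_nonneg_right ?_ (hx.1 _ e.2)
      have h3 : ∑ k : Fin (C e).length, c ⟨e, k⟩ = (((C e).map Prod.fst).sum : ℕ) := by
        rw [← Fin.sum_univ_fun_getElem, Nat.cast_sum]
        rfl
      rw [h3]
      exact_mod_cast hCw e
    refine h1.trans (hcost.trans ?_)
    push_cast
    have h3 := mul_le_mul_of_nonneg_left h2 (show (0 : ℝ) ≤ 8 * i by positivity)
    linarith

end Problem

end BulkRobust

theorem mainTheorem3 {V E : Type*} [Fintype V] [Fintype E]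
    (P : BulkRobust.Problem V E) (Γ : BulkRobust.PlanarEmbedding P.graph)
    (i : ℕ) (hi : 2 ≤ i) (X : Set E)
    (hX : P.LevelFeasible (i - 1) X)
    (hrel : ∀ e ∈ X, ∃ F ∈ P.Relevant i X, e ∈ F)
    (L : Sym2 V → List (BulkRobust.Dart E)) (hL : P.IsLinkSystem X L) :
    (∀ x : Sym2 V → ℝ, P.LPFeasible i X x → P.Clean Γ X L x →
      ∃ S : Finset (Sym2 V), P.IsLinkCover i X S ∧
        (P.linkCost L S : ℝ) ≤ 8 * i * P.lpCost X L x) ∧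
    ((∃ x : Sym2 V → ℝ, P.LPFeasible i X x) →
      ∃ S : Finset (Sym2 V), P.IsLinkCover i X S ∧
        ∀ x : Sym2 V → ℝ, P.LPFeasible i X x →
          (P.linkCost L S : ℝ) ≤ 8 * i * P.lpCost X L x) := by
  classical
  refine ⟨fun x hx _ => BulkRobust.Problem.exists_isLinkCover_le Γ hX hrel hL hx, ?_⟩
  rintro ⟨x₀, hx₀⟩
  obtain ⟨S₀, hS₀, -⟩ := BulkRobust.Problem.exists_isLinkCover_le Γ hX hrel hL hx₀
  -- a cheapest link cover does not depend on the fractional solution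
  obtain ⟨S, hS, hmin⟩ := Finset.exists_min_image
    (Finset.univ.filter fun S => P.IsLinkCover i X S) (P.linkCost L) ⟨S₀, by simpa using hS₀⟩
  refine ⟨S, (Finset.mem_filter.1 hS).2, fun x hx => ?_⟩
  obtain ⟨S', hS', hle⟩ := BulkRobust.Problem.exists_isLinkCover_le Γ hX hrel hL hx
  exact ((Nat.cast_le (α := ℝ)).2 (hmin S' (by simpa using hS'))).trans hle
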